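/- **Model.** The grid is $\mathbb Z\times\mathbb Z$ with coherently labelled ports $N,E,S,W$; $\mathrm{dist}((a,b),(c,d))=|a-c|+|b-d|$. Two identical anonymous agents $B,R$ execute the same deterministic algorithm in synchronous rounds; an adversary chooses their initial nodes (bases) and their wakeup rounds, and the agents know nothing about these. An agent that has not been woken up stays at its base. In each round an awake agent stays or moves to an adjacent node. Initially exactly the two bases are marked; every visited node becomes marked forever, and an agent arriving at a node sees whether the node was already marked. An agent makes a *hit* when it visits for the first time a node which is already marked (its own base is not counted). Rendezvous occurs when both agents are at the same node in the same round. The *time of rendezvous* is the number of rounds from the wakeup of the later agent to the first meeting, and is $0$ if the meeting takes place before that wakeup. **Algorithm Hardest Scenario** (interrupted at rendezvous). 1. Follow the square spiral: for $p=1,2,\dots$ go $N$ for $2p-1$ rounds, $W$ for $2p-1$ rounds, $S$ for $2p$ rounds, $E$ for $2p$ rounds. Stop at the first hit. Let $u$ be the node of this hit, $T$ the trajectory from the base to $u$, $\hat T$ its reverse, and $\mathrm{pred}_T(u)$ the predecessor of $u$ on $T$. Let $T.\mathrm{width}$ (resp. $T.\mathrm{height}$) be the distance between the extreme vertical (resp.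 horizontal) lines intersecting $T$. 2. PredecessorProbe: stay at $u$ for $T.\mathrm{height}$ rounds if the hit was horizontal, and for $T.\mathrm{width}$ rounds if it was vertical; then move to $\mathrm{pred}_T(u)$ and back to $u$. 3. Record for the $W$-, $S$-, $E$-, $N$-neighbour of $u$, in this order, whether it is on $T$ ($1$) or not ($0$); $*$ means either value. On inputs $(0,1,*,0)$ and $(1,*,0,0)$ choose Action II: stay at $u$ forever. On inputs $(*,0,0,1)$ and $(0,0,1,*)$ choose Action I: follow $\hat T$, then $T$, and repeat this forever. (On the other eight inputs the table prescribes no action.) **Theorem.** (a) For all bases and all wakeup rounds, Algorithm Hardest Scenario achieves rendezvous. (b) If the bases are at distance at most $D$, then for all wakeup rounds the time of rendezvous is at most $12D^2+14D+2$; this bound is $O(D^2)$. (c) Suppose that both agents $X\in\{B,R\}$ make a first hit, at node $u_X$ in round $t_X$ and with trajectory $T_X$, and that they do not meet before round $\max(t_B,t_R)$. Let $\overline X$ denote the agent other than $X$, and let $a_X,b_X,c_X,d_X$ be the first four corners (nodes where the direction changes) on $\hat T_X$, missing corners being replaced by the base of $X$. Then: * (Hitting region.) For each $X$, one or two neighbours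 of $u_X$ are on $T_X$, and among them there is a unique one, $v_X$, closest to $d_X$. If there is exactly one such neighbour, then $u_{\overline X}$ is $\mathrm{pred}_{T_X}(u_X)$ or a node of the (axis-parallel) segment between $c_X$ and $d_X$. If there are exactly two, then $u_{\overline X}$ is $\mathrm{pred}_{T_X}(u_X)$ or a node of the (axis-parallel) segment between $d_X$ and $v_X$. * If $u_X=\mathrm{pred}_{T_{\overline X}}(u_{\overline X})$ for some $X$, then either rendezvous occurs before the earlier of the two rounds in which the agents (would) start the third part, or the decision table prescribes different actions to the two agents. * If $u_X\neq\mathrm{pred}_{T_{\overline X}}(u_{\overline X})$ for both $X$, then the decision table prescribes different actions to the two agents. -/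

import Mathlib

namespace GridRendezvous

/-! ### The oriented grid -/

/-- Nodes of the infinite oriented grid `ℤ × ℤ`: the first coordinate grows towards East,
the second one towards North. -/
abbrev Node := ℤ × ℤ

/-- The four port labels. -/
inductive Dir
  | N | E | S | W

/-- The unit vector of a direction. -/
def Dir.vec : Dir → Node
  | .N => (0, 1)
  | .E => (1, 0)
  | .S => (0, -1)
  | .W => (-1, 0)

/-- The opposite direction. -/
def Dir.opp : Dir → Dir
  | .N => .S
  | .E => .W
  | .S => .N
  | .W => .E

/-- The distance in the grid. -/
def gridDist (u v : Node) : ℕ := (u.1 - v.1).natAbs + (u.2 - v.2).natAbs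

/-- The node reached from `u` in one round: `none` means staying idle. -/
def moveBy (u : Node) : Option Dir → Node
  | none => u
  | some d => u + d.vec

/-! ### Agents, marks and executions -/

/-- The two agents. -/
inductive Agent
  | B | R

/-- The agent different from the given one. -/
def Agent.other : Agent → Agent
  | .B => .R
  | .R => .B

/-- A deterministic algorithm of an anonymous agent. Its input is the chronological list of
everything that the agent has observed since its wakeup: the `i`-th entry tells whether the node
at which the agent is `i` rounds after its wakeup was marked when the agent came there
(the entry number `0` concerns the base, which is always marked). Its output is the move made in the
next round. An agent knows neither its position in the grid, nor the other agent, nor the delay.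
Its own past moves are determined by the list of observations. -/
abbrev Algorithm := List Bool → Option Dir

/-- The state of the system at the end of a round: the positions of the agents, what they have
observed, and the set of marked nodes. -/
structure Config where
  pos : Agent → Node
  obs : Agent → List Bool
  marked : Finset Node

/-- In the beginning both agents are at their bases, and only the bases are marked. -/
def initConfig (base : Agent → Node) : Config where
  pos := base
  obs := fun _ => [true]
  marked := {base .B, base .R}

/-- The position of agent `X` one round after the configuration `c` at time `t`:
an agent that has not been woken up by time `t` stays at its base. -/
def nextPos (A : Algorithm) (wake : Agent → ℕ) (t : ℕ) (c : Config) (X : Agent) : Node :=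
  if wake X ≤ t then moveBy (c.pos X) (A (c.obs X)) else c.pos X

/-- One synchronous round. Each awake agent moves (or stays), observes whether the node it came
to was marked before this round, and then all nodes occupied by the agents become marked. -/
def stepConfig (A : Algorithm) (wake : Agent → ℕ) (t : ℕ) (c : Config) : Config where
  pos := nextPos A wake t c
  obs := fun X =>
    if wake X ≤ t then c.obs X ++ [decide (nextPos A wake t c X ∈ c.marked)] else c.obs X
  marked := c.marked ∪ {nextPos A wake t c .B, nextPos A wake t c .R}

/-- The execution in which both agents use algorithm `A`, agent `X` has base `base X`
and is woken up at time `wake X`, so that it makes its first move between the times `wake X`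
and `wake X + 1`. (The execution is continued after a rendezvous, which has no influence on what
happens until then.) -/
def run (A : Algorithm) (base : Agent → Node) (wake : Agent → ℕ) : ℕ → Config
  | 0 => initConfig base
  | t + 1 => stepConfig A wake t (run A base wake t)

/-- The agents are at the same node at time `t`. -/
def Meets (A : Algorithm) (base : Agent → Node) (wake : Agent → ℕ) (t : ℕ) : Prop :=
  (run A base wake t).pos .B = (run A base wake t).pos .R

/-- `τ` is the time of rendezvous: the number of rounds between the wakeup of the later agent and
the first meeting. It is `0` if the meeting occurs before the later agent is woken up
(truncated subtraction). -/
def IsRendezvousTime (A : Algorithm) (base : Agent → Node) (wake : Agent → ℕ) (τ : ℕ) : Prop :=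
  ∃ t, IsLeast {s | Meets A base wake s} t ∧ τ = t - max (wake .B) (wake .R)

/-- Agent `X` makes a hit in round `t`: it visits for the first time a node which
was already marked. -/
def MakesHit (A : Algorithm) (base : Agent → Node) (wake : Agent → ℕ) (X : Agent) (t : ℕ) : Prop :=
  ∃ s, t = s + 1 ∧ wake X ≤ s ∧
    (run A base wake (s + 1)).pos X ∈ (run A base wake s).marked ∧
    ∀ r ≤ s, (run A base wake r).pos X ≠ (run A base wake (s + 1)).pos X

/-- Agent `X` makes its first hit in round `t`. -/
def IsFirstHit (A : Algorithm) (base : Agent → Node) (wake : Agent → ℕ) (X : Agent)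
    (t : ℕ) : Prop :=
  IsLeast {s | MakesHit A base wake X s} t

/-- The trajectory of agent `X` from its base (at its wakeup) up to time `t`. -/
def trajectory (A : Algorithm) (base : Agent → Node) (wake : Agent → ℕ) (X : Agent) (t : ℕ) :
    List Node :=
  (List.range (t - wake X + 1)).map fun i => (run A base wake (wake X + i)).pos X

/-! ### Trajectories (nonempty lists of nodes) -/

/-- The last node `u` of a trajectory. -/
def lastNode (T : List Node) : Node := T.getLastD (0, 0)

/-- The predecessor of the last node of a trajectory. -/
def predNode (T : List Node) : Node := T.dropLast.getLastD (0, 0)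

/-- The distance between the leftmost and the rightmost vertical lines that intersect `T`. -/
def width (T : List Node) : ℕ :=
  T.toFinset.sup fun u => T.toFinset.sup fun v => (u.1 - v.1).natAbs

/-- The distance between the top and the bottom horizontal lines that intersect `T`. -/
def height (T : List Node) : ℕ :=
  T.toFinset.sup fun u => T.toFinset.sup fun v => (u.2 - v.2).natAbs

/-- The number of rounds for which an agent with main trajectory `T` waits at the node of its first
hit: `height T` if the hit is horizontal, and `width T` if it is vertical. -/
def probeWait (T : List Node) : ℕ :=
  if (predNode T).2 = (lastNode T).2 then height T else width T

/-- The two possible actions in the third part of the algorithm. -/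
inductive FinalAction
  | I | II

/-- The decision table. The inputs tell whether the `W`-, `S`-, `E`- and `N`-neighbor of the
node of the first hit, in this order, are on the main trajectory. The table is undefined (`none`)
on the other eight inputs. -/
def decisionTable : Bool → Bool → Bool → Bool → Option FinalAction
  | false, true,  _,     false => some .II
  | _,     false, false, true  => some .I
  | false, false, true,  _     => some .I
  | true,  _,     false, false => some .II
  | _,     _,     _,     _     => none

/-- The action prescribed by the decision table to an agent with main trajectory `T`. -/
def chosenAction (T : List Node) : Option FinalAction :=
  decisionTable
    (decide (lastNode T + Dir.W.vec ∈ T)) (decide (lastNode T + Dir.S.vec ∈ T))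
    (decide (lastNode T + Dir.E.vec ∈ T)) (decide (lastNode T + Dir.N.vec ∈ T))

/-! ### Algorithm Hardest Scenario -/

/-- The moves of the square spiral in the `p`-th turn of its loop. -/
def spiralTurn (p : ℕ) : List Dir :=
  List.replicate (2 * p - 1) .N ++ List.replicate (2 * p - 1) .W ++
    List.replicate (2 * p) .S ++ List.replicate (2 * p) .E

/-- The moves of the square spiral in the turns `p = 1, …, m` of its loop. -/
def spiralMoves (m : ℕ) : List Dir :=
  (List.range m).flatMap fun i => spiralTurn (i + 1)

theorem lt_length_spiralMoves (n : ℕ) : n < (spiralMoves (n + 1)).length := by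
  induction n with
  | zero => simp [spiralMoves, spiralTurn]
  | succ n ih =>
    have h : spiralMoves (n + 1 + 1) = spiralMoves (n + 1) ++ spiralTurn (n + 1 + 1) := by
      simp only [spiralMoves, List.range_succ (n := n + 1), List.flatMap_append,
        List.flatMap_singleton]
    rw [h, List.length_append]
    have h2 : 1 ≤ (spiralTurn (n + 1 + 1)).length := by
      simp only [spiralTurn, List.length_append, List.length_replicate]
      omega
    omega

/-- The `n`-th move (counted from `0`) of the infinite square spiral. -/
def squareSpiral (n : ℕ) : Dir := (spiralMoves (n + 1))[n]'(lt_length_spiralMoves n)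

/-- The node reached after `n` moves of the square spiral, in the coordinates whose origin
is the base of the agent. -/
def spiralNode : ℕ → Node
  | 0 => (0, 0)
  | n + 1 => spiralNode n + (squareSpiral n).vec

/-- The first `k` moves of the square spiral, as a trajectory. -/
def spiralPath (k : ℕ) : List Node := (List.range (k + 1)).map spiralNode

/-- The number of rounds after which an agent that follows the square spiral makes its first hit,
if this has already happened: the first positive `k` for which the node reached after `k` moves
was marked although the agent had not visited it before. -/
def firstHit (obs : List Bool) : Option ℕ :=
  (List.range obs.length).find? fun k =>
    decide (0 < k) && obs.getD k false && decide (spiralNode k ∉ (List.range k).map spiralNode)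

/-- Procedure PredecessorProbe after `k` moves of the spiral: wait, move to the predecessor of the
node of the hit, and return. -/
def probeMoves (k : ℕ) : List (Option Dir) :=
  List.replicate (probeWait (spiralPath k)) none ++
    [some (squareSpiral (k - 1)).opp, some (squareSpiral (k - 1))]

/-- One turn of the loop of Procedure Swing: follow the reverse of the main trajectory, and
then the main trajectory. -/
def swingMoves (k : ℕ) : List (Option Dir) :=
  ((List.range k).reverse.map fun i => some (squareSpiral i).opp) ++
    (List.range k).map fun i => some (squareSpiral i)

/-- The `j`-th move (counted from `0`) in the third part, if the first hit occurred after `k` moves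
of the spiral: Action I repeats Procedure Swing forever, Action II is staying forever. (The agent
also stays on inputs for which the decision table is undefined.) -/
def thirdPartMove (k j : ℕ) : Option Dir :=
  match chosenAction (spiralPath k) with
  | some .I => (swingMoves k).getD (j % (swingMoves k).length) none
  | some .II => none
  | none => none

/-- Algorithm Hardest Scenario: the square spiral until the first hit, then PredecessorProbe, then
Action I or Action II according to the decision table. -/
def hardestScenario : Algorithm := fun obs =>
  match firstHit obs with
  | none => some (squareSpiral (obs.length - 1))
  | some k =>
    let j := obs.length - 1 - k
    if j < (probeMoves k).length then (probeMoves k).getD j none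
    else thirdPartMove k (j - (probeMoves k).length)

/-! ### Notions concerning main trajectories -/

/-- The neighbors of the last node of `T` that are on `T`. -/
def neighborsOn (T : List Node) : Finset Node :=
  T.toFinset.filter fun v => gridDist v (lastNode T) = 1

/-- The corners of a trajectory, i.e. the nodes at which it changes direction, in the order
of visits. -/
def corners : List Node → List Node
  | x :: y :: z :: l =>
    if y - x = z - y then corners (y :: z :: l) else y :: corners (y :: z :: l)
  | _ => []

/-- The `i`-th corner (counted from `0`) on the reverse of the trajectory `T`. If there is no such
corner, it is the base, i.e. the first node of `T`. -/
def revCorner (T : List Node) (i : ℕ) : Node := (corners T.reverse).getD i (T.headD (0, 0))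

/-- `v` is the unique node closest to `d` in the set of neighbors of the last node of `T` that
are on `T`. -/
def IsClosestNeighbor (T : List Node) (d v : Node) : Prop :=
  v ∈ neighborsOn T ∧ ∀ w ∈ neighborsOn T, w ≠ v → gridDist v d < gridDist w d

/-- The set of nodes of the segment with ends `a` and `b`, which have to be on one vertical or
horizontal line (otherwise the set is empty). -/
def gridSegment (a b : Node) : Set Node :=
  {q | (a.1 = b.1 ∨ a.2 = b.2) ∧ q ∈ Set.uIcc a b}

/-- A restriction on the node `q` of the first hit of the other agent, in terms of the main
trajectory `T` of an agent: if exactly one neighbor of the last node of `T` is on `T`, then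
`q` is the predecessor of that last node or lies between the third and the fourth corner of the
reverse trajectory; otherwise exactly two neighbors are on `T`, and `q` is the predecessor or lies
between the fourth corner and the neighbor closest to it. -/
def HitRegion (T : List Node) (q : Node) : Prop :=
  ∃ v, IsClosestNeighbor T (revCorner T 3) v ∧
    (((neighborsOn T).card = 1 ∧ (q = predNode T ∨ q ∈ gridSegment (revCorner T 2) (revCorner T 3))) ∨
      ((neighborsOn T).card = 2 ∧ (q = predNode T ∨ q ∈ gridSegment (revCorner T 3) v)))

/-- The decision table prescribes actions for both trajectories, and these are different. -/
def DifferentActions (T T' : List Node) : Prop :=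
  ∃ a a', chosenAction T = some a ∧ chosenAction T' = some a' ∧ a ≠ a'

/-- The round in which an agent with main trajectory `T` which made its first hit in round `t`
starts the third part of the algorithm: it waits in the rounds `t + 1, …, t + probeWait T` and
moves in the next two rounds. -/
def thirdPartStart (T : List Node) (t : ℕ) : ℕ := t + probeWait T + 3

end GridRendezvous

open GridRendezvous Filter Asymptotics

namespace GridRendezvous

/-! ### The shape of the square spiral -/

/-- A description of the situation of an agent on the square spiral. The direction is the one of
the next move. The nodes visited so far form a rectangle of size about `2 * p` together with an
initial part of the next side of the spiral, which ends at the coordinate `q`. -/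
structure LegState where
  dir : Dir
  p : ℤ
  q : ℤ

namespace LegState

/-- The current node. -/
def tip : LegState → Node
  | ⟨.N, p, q⟩ => (p, q)
  | ⟨.W, p, q⟩ => (q, p + 1)
  | ⟨.S, p, q⟩ => (-p - 1, q)
  | ⟨.E, p, q⟩ => (q, -p - 1)

/-- The range of the parameters. -/
def Valid : LegState → Prop
  | ⟨.N, p, q⟩ => 0 ≤ p ∧ -p ≤ q ∧ q ≤ p
  | ⟨.W, p, q⟩ => 0 ≤ p ∧ -p ≤ q ∧ q ≤ p
  | ⟨.S, p, q⟩ => 0 ≤ p ∧ -p ≤ q ∧ q ≤ p + 1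
  | ⟨.E, p, q⟩ => 0 ≤ p ∧ -p - 1 ≤ q ∧ q ≤ p

/-- The situation after the next move. -/
def next : LegState → LegState
  | ⟨.N, p, q⟩ => if q < p then ⟨.N, p, q + 1⟩ else ⟨.W, p, p⟩
  | ⟨.W, p, q⟩ => if -p < q then ⟨.W, p, q - 1⟩ else ⟨.S, p, p + 1⟩
  | ⟨.S, p, q⟩ => if -p < q then ⟨.S, p, q - 1⟩ else ⟨.E, p, -p - 1⟩
  | ⟨.E, p, q⟩ => if q < p then ⟨.E, p, q + 1⟩ else ⟨.N, p + 1, -p - 1⟩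

/-- The set of visited nodes. -/
def Region : LegState → ℤ → ℤ → Prop
  | ⟨.N, p, q⟩, x, y => (-p ≤ x ∧ x ≤ p - 1 ∧ -p ≤ y ∧ y ≤ p) ∨ (x = p ∧ -p ≤ y ∧ y ≤ q)
  | ⟨.W, p, q⟩, x, y => (-p ≤ x ∧ x ≤ p ∧ -p ≤ y ∧ y ≤ p) ∨ (y = p + 1 ∧ q ≤ x ∧ x ≤ p)
  | ⟨.S, p, q⟩, x, y =>
    (-p ≤ x ∧ x ≤ p ∧ -p ≤ y ∧ y ≤ p + 1) ∨ (x = -p - 1 ∧ q ≤ y ∧ y ≤ p + 1)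
  | ⟨.E, p, q⟩, x, y =>
    (-p - 1 ≤ x ∧ x ≤ p ∧ -p ≤ y ∧ y ≤ p + 1) ∨ (y = -p - 1 ∧ -p - 1 ≤ x ∧ x ≤ q)

/-- The current node is the first one of its side of the spiral. -/
def IsFirst : LegState → Prop
  | ⟨.N, p, q⟩ => q = -p
  | ⟨.W, p, q⟩ => q = p
  | ⟨.S, p, q⟩ => q = p + 1
  | ⟨.E, p, q⟩ => q = -p - 1

instance (s : LegState) : Decidable s.IsFirst := by
  obtain ⟨_ | _ | _ | _, p, q⟩ := s <;> unfold IsFirst <;> infer_instance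

/-- The visited neighbor of the current node on the left of the direction of movement. -/
def inner : LegState → Node
  | ⟨.N, p, q⟩ => (p - 1, q)
  | ⟨.W, p, q⟩ => (q, p)
  | ⟨.S, p, q⟩ => (-p, q)
  | ⟨.E, p, q⟩ => (q, -p)

/-- The preceding node. -/
def pred : LegState → Node
  | ⟨.N, p, q⟩ => if q = -p then (p - 1, q) else (p, q - 1)
  | ⟨.W, p, q⟩ => if q = p then (q, p) else (q + 1, p + 1)
  | ⟨.S, p, q⟩ => if q = p + 1 then (-p, q) else (-p - 1, q + 1)
  | ⟨.E, p, q⟩ => if q = -p - 1 then (q, -p) else (q - 1, -p - 1)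

/-- The number of moves made so far. -/
def rank : LegState → ℤ
  | ⟨.N, p, q⟩ => 4 * p ^ 2 + 3 * p + q
  | ⟨.W, p, q⟩ => 4 * (p + 1) ^ 2 - 3 * (p + 1) - q
  | ⟨.S, p, q⟩ => 4 * (p + 1) ^ 2 - (p + 1) - q
  | ⟨.E, p, q⟩ => 4 * (p + 1) ^ 2 + (p + 1) + q

/-- The corners seen when going back. -/
def corner : LegState → ℕ → Node
  | ⟨.N, p, q⟩, 0 => if q = -p then (-p, -p) else (p, -p)
  | ⟨.N, p, q⟩, 1 => if q = -p then (-p, p) else (-p, -p)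
  | ⟨.N, p, q⟩, 2 => if q = -p then (p - 1, p) else (-p, p)
  | ⟨.N, p, q⟩, _ => if q = -p then (p - 1, 1 - p) else (p - 1, p)
  | ⟨.W, p, q⟩, 0 => if q = p then (p, -p) else (p, p + 1)
  | ⟨.W, p, q⟩, 1 => if q = p then (-p, -p) else (p, -p)
  | ⟨.W, p, q⟩, 2 => if q = p then (-p, p) else (-p, -p)
  | ⟨.W, p, q⟩, _ => if q = p then (max (p - 1) 0, p) else (-p, p)
  | ⟨.S, p, q⟩, 0 => if q = p + 1 then (p, p + 1) else (-p - 1, p + 1)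
  | ⟨.S, p, q⟩, 1 => if q = p + 1 then (p, -p) else (p, p + 1)
  | ⟨.S, p, q⟩, 2 => if q = p + 1 then (-p, -p) else (p, -p)
  | ⟨.S, p, q⟩, _ => if q = p + 1 then (-p, p) else (-p, -p)
  | ⟨.E, p, q⟩, 0 => if q = -p - 1 then (-p - 1, p + 1) else (-p - 1, -p - 1)
  | ⟨.E, p, q⟩, 1 => if q = -p - 1 then (p, p + 1) else (-p - 1, p + 1)
  | ⟨.E, p, q⟩, 2 => if q = -p - 1 then (p, -p) else (p, p + 1)
  | ⟨.E, p, q⟩, _ => if q = -p - 1 then (-p, -p) else (p, -p)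

theorem Valid.next {s : LegState} (h : s.Valid) : s.next.Valid := by
  obtain ⟨_ | _ | _ | _, p, q⟩ := s <;> simp only [Valid, LegState.next] at * <;>
    split_ifs <;> simp only [] <;> omega

theorem tip_next {s : LegState} (h : s.Valid) : s.next.tip = s.tip + s.dir.vec := by
  obtain ⟨_ | _ | _ | _, p, q⟩ := s <;> simp only [Valid, LegState.next] at * <;>
    split_ifs <;> simp [tip, Dir.vec] <;> omega

theorem pred_next {s : LegState} (h : s.Valid) : s.next.pred = s.tip := by
  obtain ⟨_ | _ | _ | _, p, q⟩ := s <;> simp only [Valid, LegState.next] at * <;>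
    split_ifs <;> simp only [tip, pred] <;> split_ifs <;> simp <;> omega

theorem rank_next {s : LegState} (h : s.Valid) : s.next.rank = s.rank + 1 := by
  obtain ⟨_ | _ | _ | _, p, q⟩ := s <;> simp only [Valid, LegState.next] at * <;>
    split_ifs with hq <;> simp only [rank]
  · ring
  · obtain rfl : p = q := by omega
    ring
  · ring
  · obtain rfl : p = q := by omega
    ring
  · ring
  · obtain rfl : q = -p := by omega
    ring
  · ring
  · obtain rfl : q = -p := by omega
    ring

theorem region_next {s : LegState} (h : s.Valid) (x y : ℤ) :
    s.next.Region x y ↔ s.Region x y ∨ (x, y) = s.next.tip := by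
  obtain ⟨_ | _ | _ | _, p, q⟩ := s <;> simp only [Valid, LegState.next] at * <;>
    split_ifs <;> simp only [Region, tip, Prod.mk.injEq] <;> omega

theorem not_region_tip_next {s : LegState} (h : s.Valid) :
    ¬ s.Region s.next.tip.1 s.next.tip.2 := by
  obtain ⟨_ | _ | _ | _, p, q⟩ := s <;> simp only [Valid, LegState.next] at * <;>
    split_ifs <;> simp only [Region, tip] <;> omega

theorem dir_next_eq_iff {s : LegState} (h : s.Valid) : s.next.dir = s.dir ↔ ¬ s.next.IsFirst := by
  obtain ⟨_ | _ | _ | _, p, q⟩ := s <;> simp only [Valid, LegState.next] at * <;>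
    split_ifs <;> simp [IsFirst] <;> omega

/-- Going on from an inner node of a side or from the last one does not create a new corner. -/
theorem corner_next_of_not_isFirst {s : LegState} (h : s.Valid) (hs : ¬ s.IsFirst) (i : ℕ)
    (hi : i < 4) : s.next.corner i = s.corner i := by
  obtain ⟨_ | _ | _ | _, p, q⟩ := s <;> simp only [Valid, IsFirst, LegState.next] at * <;>
    interval_cases i <;> split_ifs <;> simp only [corner] <;> split_ifs <;> simp <;> omega

theorem corner_zero_next_of_isFirst {s : LegState} (h : s.Valid) (hs : s.IsFirst)
    (h0 : s.dir = .N → 1 ≤ s.p) : s.next.corner 0 = s.tip := by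
  obtain ⟨_ | _ | _ | _, p, q⟩ := s <;> simp only [Valid, IsFirst, LegState.next] at * <;>
    split_ifs <;> simp only [corner, tip] <;> split_ifs <;> simp <;> grind

theorem corner_succ_next_of_isFirst {s : LegState} (h : s.Valid) (hs : s.IsFirst)
    (h0 : s.dir = .N → 1 ≤ s.p) (i : ℕ) (hi : i < 3) :
    s.next.corner (i + 1) = s.corner i := by
  obtain ⟨_ | _ | _ | _, p, q⟩ := s <;> simp only [Valid, IsFirst, LegState.next] at * <;>
    interval_cases i <;> split_ifs <;> simp only [corner, zero_add, Nat.reduceAdd] <;>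
    split_ifs <;> simp <;> grind

end LegState

/-- The situation after `k` moves of the square spiral. -/
def legState : ℕ → LegState
  | 0 => ⟨.N, 0, 0⟩
  | k + 1 => (legState k).next

theorem valid_legState (k : ℕ) : (legState k).Valid := by
  induction k with
  | zero => simp [legState, LegState.Valid]
  | succ k ih => exact ih.next

/-- The next `n` directions after `k` moves. -/
def legDirs (k n : ℕ) : List Dir := (List.range n).map fun i => (legState (k + i)).dir

theorem legDirs_add (k m n : ℕ) : legDirs k (m + n) = legDirs k m ++ legDirs (k + m) n := by
  simp [legDirs, List.range_add, Function.comp_def, add_assoc]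

theorem legDirs_succ (k n : ℕ) : legDirs k (n + 1) = (legState k).dir :: legDirs (k + 1) n := by
  rw [add_comm n 1, legDirs_add]
  simp [legDirs]

theorem legState_N (k j : ℕ) (p : ℤ) (h : legState k = ⟨.N, p, p - j⟩) :
    legDirs k (j + 1) = List.replicate (j + 1) .N ∧ legState (k + j + 1) = ⟨.W, p, p⟩ := by
  induction j generalizing k with
  | zero => simp [legDirs, legState, h, LegState.next]
  | succ j ih =>
    have h' : legState (k + 1) = ⟨.N, p, p - j⟩ := by
      rw [legState, h, LegState.next, if_pos (by push_cast; omega)]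
      congr 1
      push_cast
      ring
    obtain ⟨h1, h2⟩ := ih _ h'
    rw [legDirs_succ, h1, h, List.replicate_succ (n := j + 1)]
    exact ⟨rfl, by rw [← h2]; congr 1; omega⟩

theorem legState_W (k j : ℕ) (p : ℤ) (h : legState k = ⟨.W, p, -p + j⟩) :
    legDirs k (j + 1) = List.replicate (j + 1) .W ∧ legState (k + j + 1) = ⟨.S, p, p + 1⟩ := by
  induction j generalizing k with
  | zero => simp [legDirs, legState, h, LegState.next]
  | succ j ih =>
    have h' : legState (k + 1) = ⟨.W, p, -p + j⟩ := by
      rw [legState, h, LegState.next, if_pos (by push_cast; omega)]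
      simp [add_sub_assoc]
    obtain ⟨h1, h2⟩ := ih _ h'
    rw [legDirs_succ, h1, h, List.replicate_succ (n := j + 1)]
    exact ⟨rfl, by rw [← h2]; congr 1; omega⟩

theorem legState_S (k j : ℕ) (p : ℤ) (h : legState k = ⟨.S, p, -p + j⟩) :
    legDirs k (j + 1) = List.replicate (j + 1) .S ∧ legState (k + j + 1) = ⟨.E, p, -p - 1⟩ := by
  induction j generalizing k with
  | zero => simp [legDirs, legState, h, LegState.next]
  | succ j ih =>
    have h' : legState (k + 1) = ⟨.S, p, -p + j⟩ := by
      rw [legState, h, LegState.next, if_pos (by push_cast; omega)]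
      simp [add_sub_assoc]
    obtain ⟨h1, h2⟩ := ih _ h'
    rw [legDirs_succ, h1, h, List.replicate_succ (n := j + 1)]
    exact ⟨rfl, by rw [← h2]; congr 1; omega⟩

theorem legState_E (k j : ℕ) (p : ℤ) (h : legState k = ⟨.E, p, p - j⟩) :
    legDirs k (j + 1) = List.replicate (j + 1) .E ∧
      legState (k + j + 1) = ⟨.N, p + 1, -p - 1⟩ := by
  induction j generalizing k with
  | zero => simp [legDirs, legState, h, LegState.next]
  | succ j ih =>
    have h' : legState (k + 1) = ⟨.E, p, p - j⟩ := by
      rw [legState, h, LegState.next, if_pos (by push_cast; omega)]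
      congr 1
      push_cast
      ring
    obtain ⟨h1, h2⟩ := ih _ h'
    rw [legDirs_succ, h1, h, List.replicate_succ (n := j + 1)]
    exact ⟨rfl, by rw [← h2]; congr 1; omega⟩

theorem spiralMoves_eq_legDirs (m : ℕ) :
    spiralMoves m = legDirs 0 (4 * m ^ 2 + 2 * m) ∧
      legState (4 * m ^ 2 + 2 * m) = ⟨.N, m, -m⟩ := by
  induction m with
  | zero => simp [spiralMoves, legDirs, legState]
  | succ m ih =>
    obtain ⟨ih1, ih2⟩ := ih
    set k := 4 * m ^ 2 + 2 * m with hk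
    obtain ⟨n1, n2⟩ := legState_N k (2 * m) m (by rw [ih2]; congr 1; push_cast; ring)
    obtain ⟨w1, w2⟩ := legState_W _ (2 * m) m (n2.trans (by congr 1; push_cast; ring))
    obtain ⟨s1, s2⟩ := legState_S _ (2 * m + 1) m (w2.trans (by congr 1; push_cast; ring))
    obtain ⟨e1, e2⟩ := legState_E _ (2 * m + 1) m (s2.trans (by congr 1; push_cast; ring))
    have hk' : 4 * (m + 1) ^ 2 + 2 * (m + 1) =
        k + (2 * m + 1) + (2 * m + 1) + (2 * m + 1 + 1) + (2 * m + 1 + 1) := by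
      rw [hk]; ring
    constructor
    · have h : spiralMoves (m + 1) = spiralMoves m ++ spiralTurn (m + 1) := by
        simp only [spiralMoves, List.range_succ (n := m), List.flatMap_append,
          List.flatMap_singleton]
      rw [h, ih1, hk', legDirs_add 0 _ (2 * m + 1 + 1), legDirs_add 0 _ (2 * m + 1 + 1),
        legDirs_add 0 _ (2 * m + 1), legDirs_add 0 k (2 * m + 1)]
      clear_value k
      simp only [zero_add, ← add_assoc] at *
      rw [n1, w1, s1, e1]
      simp [spiralTurn,
        show 2 * (m + 1) = 2 * m + (1 + 1) by omega]
    · rw [hk']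
      refine Eq.trans ?_ (e2.trans ?_)
      · congr 1
      · congr 1
        push_cast
        ring

theorem squareSpiral_eq (n : ℕ) : squareSpiral n = (legState n).dir := by
  unfold squareSpiral
  simp [(spiralMoves_eq_legDirs (n + 1)).1, legDirs]

theorem spiralNode_eq_tip (k : ℕ) : spiralNode k = (legState k).tip := by
  induction k with
  | zero => rfl
  | succ k ih =>
    rw [spiralNode, ih, squareSpiral_eq, legState, LegState.tip_next (valid_legState k)]

theorem rank_legState (k : ℕ) : (legState k).rank = k := by
  induction k with
  | zero => rfl
  | succ k ih =>
    rw [legState, LegState.rank_next (valid_legState k), ih]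
    push_cast
    rfl

theorem mem_spiralPath_iff_exists {k : ℕ} {v : Node} :
    v ∈ spiralPath k ↔ ∃ i ≤ k, spiralNode i = v := by
  simp [spiralPath]

theorem mem_spiralPath {k : ℕ} {v : Node} :
    v ∈ spiralPath k ↔ (legState k).Region v.1 v.2 := by
  induction k generalizing v with
  | zero =>
    obtain ⟨x, y⟩ := v
    simp only [spiralPath, legState, LegState.Region, zero_add, List.range_one, List.map_cons,
      List.map_nil, List.mem_singleton, spiralNode, Prod.mk.injEq]
    omega
  | succ k ih =>
    rw [legState, LegState.region_next (valid_legState k), ← ih, spiralPath,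
      List.range_succ (n := k + 1), List.map_append, List.mem_append]
    simp [spiralPath, spiralNode_eq_tip, legState]

theorem spiralNode_injective : Function.Injective spiralNode := by
  have key : ∀ i j, i < j → spiralNode i ≠ spiralNode j := by
    intro i j hij h
    obtain ⟨j, rfl⟩ : ∃ j', j = j' + 1 := ⟨j - 1, by omega⟩
    refine LegState.not_region_tip_next (valid_legState j) (mem_spiralPath.1 ?_)
    exact mem_spiralPath_iff_exists.2 ⟨i, by omega, h.trans (spiralNode_eq_tip _)⟩
  intro i j h
  rcases lt_trichotomy i j with hij | hij | hij
  · exact absurd h (key i j hij)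
  · exact hij
  · exact absurd h.symm (key j i hij)

theorem legState_pred {k : ℕ} (hk : 0 < k) : (legState k).pred = spiralNode (k - 1) := by
  obtain ⟨k, rfl⟩ : ∃ k', k = k' + 1 := ⟨k - 1, by omega⟩
  rw [legState, LegState.pred_next (valid_legState k), Nat.add_sub_cancel, spiralNode_eq_tip]

/-- Only the initial node is in a state with direction `N` and parameter `0`. -/
theorem one_le_p_legState {k : ℕ} (hk : 0 < k) (h : (legState k).dir = .N) :
    1 ≤ (legState k).p := by
  obtain ⟨k, rfl⟩ : ∃ k', k = k' + 1 := ⟨k - 1, by omega⟩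
  have hr := rank_legState (k + 1)
  have hv := valid_legState (k + 1)
  generalize legState (k + 1) = s at *
  obtain ⟨d, p, q⟩ := s
  simp only at h
  subst h
  simp only [LegState.rank, LegState.Valid] at *
  by_contra hp
  obtain rfl : p = 0 := by omega
  omega

theorem legState_arm (D : ℕ) : legState (4 * D ^ 2 + 3 * D) = ⟨.N, D, 0⟩ := by
  have h : ∀ j : ℕ, j ≤ 2 * D → legState (4 * D ^ 2 + 2 * D + j) = ⟨.N, D, -D + j⟩ := by
    intro j hj
    induction j with
    | zero => simpa using (spiralMoves_eq_legDirs D).2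
    | succ j ih =>
      rw [← add_assoc, legState, ih (by omega), LegState.next, if_pos (by omega), add_assoc]
      rfl
  have := h D (by omega)
  rw [show 4 * D ^ 2 + 2 * D + D = 4 * D ^ 2 + 3 * D by ring] at this
  simpa using this

/-- The ball of radius `D` is explored within `4 * D ^ 2 + 3 * D` moves. -/
theorem exists_spiralNode_eq {D : ℕ} {v : Node} (hv : v.1.natAbs + v.2.natAbs ≤ D) :
    ∃ k ≤ 4 * D ^ 2 + 3 * D, spiralNode k = v := by
  rw [← mem_spiralPath_iff_exists, mem_spiralPath, legState_arm]
  simp only [LegState.Region]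
  omega

theorem natAbs_spiralNode_le {D k : ℕ} (hk : k ≤ 4 * D ^ 2 + 3 * D) :
    (spiralNode k).1.natAbs ≤ D ∧ (spiralNode k).2.natAbs ≤ D := by
  have h : spiralNode k ∈ spiralPath (4 * D ^ 2 + 3 * D) :=
    mem_spiralPath_iff_exists.2 ⟨k, hk, rfl⟩
  rw [mem_spiralPath, legState_arm] at h
  simp only [LegState.Region] at h
  omega

/-! ### The corners of the spiral -/

theorem reverse_spiralPath_succ (k : ℕ) :
    (spiralPath (k + 1)).reverse = spiralNode (k + 1) :: (spiralPath k).reverse := by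
  simp [spiralPath, List.range_succ (n := k + 1)]

theorem Dir.vec_injective : Function.Injective Dir.vec := by
  rintro (_ | _ | _ | _) (_ | _ | _ | _) <;> simp [Dir.vec]

theorem corners_reverse_spiralPath (k : ℕ) :
    corners (spiralPath (k + 2)).reverse =
      if (legState (k + 1)).IsFirst then
        spiralNode (k + 1) :: corners (spiralPath (k + 1)).reverse
      else corners (spiralPath (k + 1)).reverse := by
  obtain ⟨l, hl⟩ : ∃ l, (spiralPath k).reverse = spiralNode k :: l := by
    cases k with
    | zero => exact ⟨[], rfl⟩
    | succ k => exact ⟨_, reverse_spiralPath_succ k⟩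
  have h1 : spiralNode k - spiralNode (k + 1) = -(squareSpiral k).vec := sub_add_cancel_left _ _
  have h2 : spiralNode (k + 1) - spiralNode (k + 2) = -(squareSpiral (k + 1)).vec :=
    sub_add_cancel_left _ _
  have h : (spiralNode (k + 1) - spiralNode (k + 2) = spiralNode k - spiralNode (k + 1)) ↔
      ¬ (legState (k + 1)).IsFirst := by
    rw [legState, ← LegState.dir_next_eq_iff (valid_legState k), ← Dir.vec_injective.eq_iff,
      ← legState, ← squareSpiral_eq, ← squareSpiral_eq, h1, h2, neg_inj]
  rw [reverse_spiralPath_succ, reverse_spiralPath_succ, hl, corners, ← hl]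
  by_cases hf : (legState (k + 1)).IsFirst <;> simp [h, hf]

theorem getD_corners_reverse_spiralPath {k : ℕ} (hk : 0 < k) {i : ℕ} (hi : i < 4) :
    (corners (spiralPath k).reverse).getD i 0 = (legState k).corner i := by
  induction k, hk using Nat.le_induction generalizing i with
  | base =>
    interval_cases i <;> simp [spiralPath, List.range_succ, corners, legState, LegState.next,
      LegState.corner] <;> rfl
  | succ k hk ih =>
    obtain ⟨k, rfl⟩ : ∃ k', k = k' + 1 := ⟨k - 1, by omega⟩
    have hv := valid_legState (k + 1)
    rw [corners_reverse_spiralPath]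
    change _ = (legState (k + 1)).next.corner i
    split_ifs with hf
    · have h0 := one_le_p_legState (k := k + 1) (by omega)
      cases i with
      | zero => rw [LegState.corner_zero_next_of_isFirst hv hf h0, List.getD_cons_zero,
          spiralNode_eq_tip]
      | succ i => rw [LegState.corner_succ_next_of_isFirst hv hf h0 i (by omega),
          List.getD_cons_succ, ih (by omega)]
    · rw [LegState.corner_next_of_not_isFirst hv hf i hi, ih hi]

/-! ### Two spirals that meet exactly at their ends -/

namespace LegState

/-- The nodes visited in the preceding turn of the spiral which are adjacent to the current side
and not behind the current node, and the preceding node. -/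
def Ahead : LegState → ℤ → ℤ → Prop
  | ⟨.N, p, q⟩, x, y => (x = p - 1 ∧ q ≤ y ∧ y ≤ p) ∨ (q ≠ -p ∧ x = p ∧ y = q - 1)
  | ⟨.W, p, q⟩, x, y => (y = p ∧ -p ≤ x ∧ x ≤ q) ∨ (q ≠ p ∧ x = q + 1 ∧ y = p + 1)
  | ⟨.S, p, q⟩, x, y => (x = -p ∧ -p ≤ y ∧ y ≤ q) ∨ (q ≠ p + 1 ∧ x = -p - 1 ∧ y = q + 1)
  | ⟨.E, p, q⟩, x, y => (y = -p ∧ q ≤ x ∧ x ≤ p) ∨ (q ≠ -p - 1 ∧ x = q - 1 ∧ y = -p - 1)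

/-- The states in which the decision table prescribes Action II. -/
def Upper : LegState → Prop
  | ⟨.N, _, _⟩ => True
  | ⟨.W, _, _⟩ => True
  | ⟨.S, _, _⟩ => False
  | ⟨.E, _, _⟩ => False

/-- The height of the set of visited nodes. -/
def vertical : LegState → ℤ
  | ⟨.N, p, _⟩ => 2 * p
  | ⟨.W, p, _⟩ => 2 * p + 1
  | ⟨.S, p, _⟩ => 2 * p + 1
  | ⟨.E, p, _⟩ => 2 * p + 2

/-- The validity of a state which is not the initial one. -/
def Started : LegState → Prop
  | ⟨.N, p, q⟩ => 1 ≤ p ∧ -p ≤ q ∧ q ≤ p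
  | ⟨.W, p, q⟩ => 0 ≤ p ∧ -p ≤ q ∧ q ≤ p
  | ⟨.S, p, q⟩ => 0 ≤ p ∧ -p ≤ q ∧ q ≤ p + 1
  | ⟨.E, p, q⟩ => 0 ≤ p ∧ -p - 1 ≤ q ∧ q ≤ p

/-- Two spirals have exactly two common nodes, namely the last nodes of both. The difference of
their bases is `(dx, dy)`. -/
def MeetAtTips (s t : LegState) (dx dy : ℤ) : Prop :=
  t.Region (s.tip.1 - dx) (s.tip.2 - dy) ∧ s.Region (t.tip.1 + dx) (t.tip.2 + dy) ∧
    (s.tip.1 = t.tip.1 + dx → s.tip.2 ≠ t.tip.2 + dy) ∧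
    ∀ x y, s.Region x y → t.Region (x - dx) (y - dy) →
      x = s.tip.1 ∧ y = s.tip.2 ∨ x = t.tip.1 + dx ∧ y = t.tip.2 + dy

/-- Each of the last nodes is ahead of the other spiral, and the spirals are in opposite halves of
their turns or run horizontally into each other and have different heights. -/
def Separated (s t : LegState) (dx dy : ℤ) : Prop :=
  (s.Ahead (t.tip.1 + dx) (t.tip.2 + dy) ∧ t.Ahead (s.tip.1 - dx) (s.tip.2 - dy)) ∧
    ((s.Upper ↔ ¬ t.Upper) ∨
      ((s.pred.1 = t.tip.1 + dx ∧ s.pred.2 = t.tip.2 + dy) ∧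
        (t.pred.1 + dx = s.tip.1 ∧ t.pred.2 + dy = s.tip.2) ∧
        s.tip.2 = t.tip.2 + dy ∧ s.vertical % 2 ≠ t.vertical % 2))

theorem MeetAtTips.swap {s t : LegState} {dx dy : ℤ} (h : s.MeetAtTips t dx dy) :
    t.MeetAtTips s (-dx) (-dy) := by
  obtain ⟨h1, h2, h3, h4⟩ := h
  refine ⟨by simpa using h2, by simpa [← sub_eq_add_neg] using h1, by omega, fun x y hx hy => ?_⟩
  have := h4 (x + dx) (y + dy) (by simpa using hy) (by simpa using hx)
  omega

theorem Separated.swap {s t : LegState} {dx dy : ℤ} (h : s.Separated t dx dy) :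
    t.Separated s (-dx) (-dy) := by
  obtain ⟨⟨h1, h2⟩, h3⟩ := h
  refine ⟨⟨by simpa [← sub_eq_add_neg] using h2, by simpa using h1⟩, ?_⟩
  rcases h3 with h3 | h3
  · exact Or.inl (by tauto)
  · exact Or.inr (by omega)

theorem MeetAtTips.separated_N {p q p' q' : ℤ} {d : Dir} {dx dy : ℤ}
    (hs : Started ⟨.N, p, q⟩) (ht : Started ⟨d, p', q'⟩)
    (h : MeetAtTips ⟨.N, p, q⟩ ⟨d, p', q'⟩ dx dy) :
    Separated ⟨.N, p, q⟩ ⟨d, p', q'⟩ dx dy := by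
  obtain ⟨h1, h2, hne, hint⟩ := h
  have ta := hint ((tip ⟨d, p', q'⟩).1 + dx + 1) ((tip ⟨d, p', q'⟩).2 + dy)
  have tc := hint ((tip ⟨d, p', q'⟩).1 + dx) ((tip ⟨d, p', q'⟩).2 + dy + 1)
  have td := hint ((tip ⟨d, p', q'⟩).1 + dx) ((tip ⟨d, p', q'⟩).2 + dy - 1)
  clear hint
  cases d <;>
    simp only [Started, Separated, Region, Ahead, Upper, vertical, tip, pred,
      not_true, not_false_eq_true, iff_self, true_or, false_or, and_true, iff_false,
      apply_ite Prod.fst, apply_ite Prod.snd] at *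
  · clear ta tc td
    rcases h1 with h1 | h1 <;> rcases h2 with h2 | h2 <;>
      exfalso <;> omega
  · clear ta td
    rcases h1 with h1 | h1 <;> rcases h2 with h2 | h2 <;>
      (first | (exfalso; omega) | (refine ⟨?_, ?_⟩ <;> omega))
  · clear td
    rcases h1 with h1 | h1 <;> rcases h2 with h2 | h2 <;>
      (first | (exfalso; omega) | (refine ⟨?_, ?_⟩ <;> omega))
  · clear tc
    rcases h1 with h1 | h1 <;> rcases h2 with h2 | h2 <;>
      (first | (exfalso; omega) | (refine ⟨?_, ?_⟩ <;> omega))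

theorem MeetAtTips.separated_W {p q p' q' : ℤ} {d : Dir} {dx dy : ℤ} (hd : d ≠ .N)
    (hs : Started ⟨.W, p, q⟩) (ht : Started ⟨d, p', q'⟩)
    (h : MeetAtTips ⟨.W, p, q⟩ ⟨d, p', q'⟩ dx dy) :
    Separated ⟨.W, p, q⟩ ⟨d, p', q'⟩ dx dy := by
  obtain ⟨h1, h2, hne, hint⟩ := h
  have tb := hint ((tip ⟨d, p', q'⟩).1 + dx - 1) ((tip ⟨d, p', q'⟩).2 + dy)
  have tc := hint ((tip ⟨d, p', q'⟩).1 + dx) ((tip ⟨d, p', q'⟩).2 + dy + 1)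
  have sd := hint (tip ⟨.W, p, q⟩).1 ((tip ⟨.W, p, q⟩).2 - 1)
  clear hint
  cases d <;>
    simp only [Started, Separated, Region, Ahead, Upper, vertical, tip, pred,
      not_true, not_false_eq_true, iff_self, true_or, false_or, and_true, iff_false,
      apply_ite Prod.fst, apply_ite Prod.snd] at *
  · exact absurd rfl hd
  · clear sd
    rcases h1 with h1 | h1 <;> rcases h2 with h2 | h2 <;>
      (first | (exfalso; omega) | (refine ⟨?_, ?_⟩ <;> omega))
  · clear tb tc
    rcases h1 with h1 | h1 <;> rcases h2 with h2 | h2 <;>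
      (first | (exfalso; omega) | (refine ⟨?_, ?_⟩ <;> omega))
  · clear tb tc sd
    rcases h1 with h1 | h1 <;> rcases h2 with h2 | h2 <;>
      exfalso <;> omega

theorem MeetAtTips.separated_S {p q p' q' : ℤ} {d : Dir} {dx dy : ℤ} (hd : d = .S ∨ d = .E)
    (hs : Started ⟨.S, p, q⟩) (ht : Started ⟨d, p', q'⟩)
    (h : MeetAtTips ⟨.S, p, q⟩ ⟨d, p', q'⟩ dx dy) :
    Separated ⟨.S, p, q⟩ ⟨d, p', q'⟩ dx dy := by
  obtain ⟨h1, h2, hne, hint⟩ := h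
  have tb := hint ((tip ⟨d, p', q'⟩).1 + dx - 1) ((tip ⟨d, p', q'⟩).2 + dy)
  have tc := hint ((tip ⟨d, p', q'⟩).1 + dx) ((tip ⟨d, p', q'⟩).2 + dy + 1)
  clear hint
  rcases hd with rfl | rfl <;>
    simp only [Started, Separated, Region, Ahead, Upper, vertical, tip, pred,
      not_false_eq_true, iff_true, false_or, and_true,
      apply_ite Prod.fst, apply_ite Prod.snd] at *
  · clear tb tc
    rcases h1 with h1 | h1 <;> rcases h2 with h2 | h2 <;>
      exfalso <;> omega
  · rcases h1 with h1 | h1 <;> rcases h2 with h2 | h2 <;>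
      (first | (exfalso; omega) | (refine ⟨?_, ?_⟩ <;> omega))

theorem MeetAtTips.separated_E {p q p' q' : ℤ} {dx dy : ℤ}
    (h : MeetAtTips ⟨.E, p, q⟩ ⟨.E, p', q'⟩ dx dy) :
    Separated ⟨.E, p, q⟩ ⟨.E, p', q'⟩ dx dy := by
  exfalso
  obtain ⟨h1, h2, hne, -⟩ := h
  simp only [Region, tip] at h1 h2 hne
  omega

theorem MeetAtTips.separated {s t : LegState} {dx dy : ℤ} (hs : s.Started) (ht : t.Started)
    (h : s.MeetAtTips t dx dy) : s.Separated t dx dy := by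
  rw [← neg_neg dx, ← neg_neg dy]
  have h' := h.swap
  rw [← neg_neg dx, ← neg_neg dy] at h
  obtain ⟨_ | _ | _ | _, p, q⟩ := s <;> obtain ⟨_ | _ | _ | _, p', q'⟩ := t
  · exact h.separated_N hs ht
  · exact h.separated_N hs ht
  · exact h.separated_N hs ht
  · exact h.separated_N hs ht
  · exact (h'.separated_N ht hs).swap
  · exact h.separated_E
  · exact (h'.separated_S (by simp) ht hs).swap
  · exact (h'.separated_W (by simp) ht hs).swap
  · exact (h'.separated_N ht hs).swap
  · exact h.separated_S (by simp) hs ht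
  · exact h.separated_S (by simp) hs ht
  · exact (h'.separated_W (by simp) ht hs).swap
  · exact (h'.separated_N ht hs).swap
  · exact h.separated_W (by simp) hs ht
  · exact h.separated_W (by simp) hs ht
  · exact h.separated_W (by simp) hs ht

end LegState
/-! ### Translates of initial parts of the spiral -/

/-- The trajectory of the first `k` moves of the spiral from the base `o`. -/
def spiralFrom (o : Node) (k : ℕ) : List Node := (spiralPath k).map (o + ·)

theorem started_legState {k : ℕ} (hk : 0 < k) : (legState k).Started := by
  have h1 := one_le_p_legState hk
  have h2 := valid_legState k
  generalize legState k = s at *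
  obtain ⟨_ | _ | _ | _, p, q⟩ := s <;> simp_all [LegState.Started, LegState.Valid]

theorem mem_spiralFrom {o v : Node} {k : ℕ} :
    v ∈ spiralFrom o k ↔ (legState k).Region (v.1 - o.1) (v.2 - o.2) := by
  have : v ∈ spiralFrom o k ↔ v - o ∈ spiralPath k := by
    simp only [spiralFrom, List.mem_map]
    constructor
    · rintro ⟨w, hw, rfl⟩
      simpa using hw
    · exact fun h => ⟨_, h, by simp⟩
  rw [this, mem_spiralPath]
  rfl

theorem mem_spiralFrom_iff_exists {o v : Node} {k : ℕ} :
    v ∈ spiralFrom o k ↔ ∃ i ≤ k, o + spiralNode i = v := by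
  simp [spiralFrom, spiralPath]

theorem lastNode_spiralFrom (o : Node) (k : ℕ) :
    lastNode (spiralFrom o k) = o + spiralNode k := by
  simp [lastNode, spiralFrom, spiralPath, List.range_succ]

theorem predNode_spiralFrom (o : Node) {k : ℕ} (hk : 0 < k) :
    predNode (spiralFrom o k) = o + spiralNode (k - 1) := by
  obtain ⟨k, rfl⟩ : ∃ k', k = k' + 1 := ⟨k - 1, by omega⟩
  simp [predNode, spiralFrom, spiralPath, List.range_succ (n := k + 1),
    List.range_succ (n := k)]

theorem headD_spiralFrom (o : Node) (k : ℕ) : (spiralFrom o k).headD (0, 0) = o := by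
  have : (0, 0) = (0 : Node) := rfl
  simp [spiralFrom, spiralPath, List.range_succ_eq_map, spiralNode, this]

theorem corners_map_add (o : Node) (l : List Node) :
    corners (l.map (o + ·)) = (corners l).map (o + ·) := by
  induction l with
  | nil => rfl
  | cons x l ih =>
    match l, ih with
    | [], _ => rfl
    | [_], _ => rfl
    | y :: z :: l, ih =>
      simp only [List.map_cons] at ih
      simp only [corners, List.map_cons, add_sub_add_left_eq_sub, ih]
      split_ifs <;> simp

theorem revCorner_spiralFrom (o : Node) {k i : ℕ} (hk : 0 < k) (hi : i < 4) :
    revCorner (spiralFrom o k) i = o + (legState k).corner i := by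
  rw [revCorner, headD_spiralFrom, spiralFrom, ← List.map_reverse, corners_map_add,
    ← getD_corners_reverse_spiralPath hk hi]
  have := List.getD_map (l := corners (spiralPath k).reverse) (d := 0) (n := i) (f := (o + ·))
  simpa using this

theorem mem_neighborsOn {o v : Node} {k : ℕ} :
    v ∈ neighborsOn (spiralFrom o k) ↔
      (legState k).Region (v.1 - o.1) (v.2 - o.2) ∧
        gridDist v (o + (legState k).tip) = 1 := by
  rw [neighborsOn, Finset.mem_filter, List.mem_toFinset, mem_spiralFrom, lastNode_spiralFrom,
    spiralNode_eq_tip]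

theorem decisionTable_eq_II {w s e n : Prop} [Decidable w] [Decidable s] [Decidable e]
    [Decidable n] (h : (w ∨ s) ∧ ¬ n ∧ (w → ¬ e)) :
    decisionTable (decide w) (decide s) (decide e) (decide n) = some .II := by
  by_cases w <;> by_cases s <;> by_cases e <;> by_cases n <;> simp_all [decisionTable]

theorem decisionTable_eq_I {w s e n : Prop} [Decidable w] [Decidable s] [Decidable e]
    [Decidable n] (h : (e ∨ n) ∧ ¬ s ∧ (e → ¬ w)) :
    decisionTable (decide w) (decide s) (decide e) (decide n) = some .I := by
  by_cases w <;> by_cases s <;> by_cases e <;> by_cases n <;> simp_all [decisionTable]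

theorem chosenAction_spiralFrom (o : Node) {k : ℕ} (hk : 0 < k) :
    (chosenAction (spiralFrom o k) = some .II ∧ (legState k).Upper) ∨
      (chosenAction (spiralFrom o k) = some .I ∧ ¬ (legState k).Upper) := by
  have hs := started_legState hk
  by_cases hu : (legState k).Upper
  · refine Or.inl ⟨decisionTable_eq_II ?_, hu⟩
    simp only [mem_spiralFrom, lastNode_spiralFrom, spiralNode_eq_tip, Prod.fst_add,
      Prod.snd_add, Dir.vec, add_assoc, add_sub_cancel_left]
    generalize legState k = s at *
    obtain ⟨_ | _ | _ | _, p, q⟩ := s <;>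
      simp only [LegState.Started, LegState.Region, LegState.tip, LegState.Upper] at * <;> omega
  · refine Or.inr ⟨decisionTable_eq_I ?_, hu⟩
    simp only [mem_spiralFrom, lastNode_spiralFrom, spiralNode_eq_tip, Prod.fst_add,
      Prod.snd_add, Dir.vec, add_assoc, add_sub_cancel_left]
    generalize legState k = s at *
    obtain ⟨_ | _ | _ | _, p, q⟩ := s <;>
      simp only [LegState.Started, LegState.Region, LegState.tip, LegState.Upper,
        not_true_eq_false] at * <;> omega

theorem region_and_adjacent_iff {s : LegState} (hs : s.Started) (x y : ℤ) :
    s.Region x y ∧ (x - s.tip.1).natAbs + (y - s.tip.2).natAbs = 1 ↔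
      (x, y) = s.inner ∨ (x, y) = s.pred := by
  obtain ⟨_ | _ | _ | _, p, q⟩ := s <;>
    simp only [LegState.Started, LegState.Region, LegState.tip, LegState.inner,
      LegState.pred] at * <;> split_ifs <;> simp only [Prod.mk.injEq] <;> omega

theorem neighborsOn_spiralFrom (o : Node) {k : ℕ} (hk : 0 < k) :
    neighborsOn (spiralFrom o k) = {o + (legState k).inner, o + (legState k).pred} := by
  ext v
  rw [mem_neighborsOn, Finset.mem_insert, Finset.mem_singleton, ← sub_eq_iff_eq_add',
    ← sub_eq_iff_eq_add', ← Prod.mk.eta (p := v - o), ← region_and_adjacent_iff (started_legState hk)]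
  simp [gridDist, sub_sub]

theorem LegState.inner_eq_pred_iff {s : LegState} :
    s.inner = s.pred ↔ s.IsFirst := by
  obtain ⟨_ | _ | _ | _, p, q⟩ := s <;>
    simp only [LegState.inner, LegState.IsFirst, LegState.pred] at * <;> split_ifs <;>
    simp only [Prod.mk.injEq, iff_false, *] <;> omega

theorem LegState.inner_closest {s : LegState} (hs : s.Started) (h : ¬ s.IsFirst) :
    gridDist s.inner (s.corner 3) < gridDist s.pred (s.corner 3) := by
  obtain ⟨_ | _ | _ | _, p, q⟩ := s <;>
    simp only [LegState.Started, LegState.inner, LegState.IsFirst, LegState.pred, LegState.corner,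
      gridDist] at * <;> split_ifs <;> dsimp only <;> omega

theorem mem_gridSegment {a b v : Node} : v ∈ gridSegment a b ↔ (a.1 = b.1 ∨ a.2 = b.2) ∧
    (min a.1 b.1 ≤ v.1 ∧ min a.2 b.2 ≤ v.2) ∧ v.1 ≤ max a.1 b.1 ∧ v.2 ≤ max a.2 b.2 :=
  Iff.rfl

theorem LegState.mem_segment_of_isFirst {s : LegState} (hs : s.Started) (h : s.IsFirst) {x y : ℤ}
    (ha : s.Ahead x y) : (x, y) = s.pred ∨ (x, y) ∈ gridSegment (s.corner 2) (s.corner 3) := by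
  obtain ⟨_ | _ | _ | _, p, q⟩ := s <;>
    simp only [LegState.Started, LegState.Ahead, LegState.IsFirst, LegState.pred, LegState.corner,
      mem_gridSegment] at * <;> split_ifs <;>
      simp only [Prod.mk.injEq, true_or, or_true, true_and] <;> omega

theorem LegState.mem_segment_of_not_isFirst {s : LegState} (hs : s.Started) (h : ¬ s.IsFirst)
    {x y : ℤ} (ha : s.Ahead x y) :
    (x, y) = s.pred ∨ (x, y) ∈ gridSegment (s.corner 3) s.inner := by
  obtain ⟨_ | _ | _ | _, p, q⟩ := s <;>
    simp only [LegState.Started, LegState.Ahead, LegState.IsFirst, LegState.pred, LegState.corner,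
      LegState.inner, mem_gridSegment] at * <;> split_ifs <;>
      simp only [Prod.mk.injEq, true_or, or_true, true_and] <;> omega

theorem gridDist_add_left (o u v : Node) : gridDist (o + u) (o + v) = gridDist u v := by
  simp [gridDist]

theorem add_mem_gridSegment {o a b v : Node} (h : v ∈ gridSegment a b) :
    o + v ∈ gridSegment (o + a) (o + b) := by
  simp only [mem_gridSegment, Prod.fst_add, Prod.snd_add] at *
  omega

theorem hitRegion_spiralFrom {o u : Node} {k : ℕ} (hk : 0 < k)
    (h : (legState k).Ahead (u.1 - o.1) (u.2 - o.2)) : HitRegion (spiralFrom o k) u := by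
  have hs := started_legState hk
  have hn := neighborsOn_spiralFrom o hk
  have hu : u = o + (u.1 - o.1, u.2 - o.2) := by ext <;> simp
  have hpred : predNode (spiralFrom o k) = o + (legState k).pred := by
    rw [predNode_spiralFrom o hk, legState_pred hk]
  refine ⟨o + (legState k).inner, ⟨by simp [hn], ?_⟩, ?_⟩
  · intro w hw hne
    rw [hn, Finset.mem_insert, Finset.mem_singleton] at hw
    obtain rfl := hw.resolve_left hne
    rw [revCorner_spiralFrom o hk (by norm_num), gridDist_add_left, gridDist_add_left]
    refine LegState.inner_closest hs fun hf => hne ?_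
    rw [LegState.inner_eq_pred_iff.2 hf]
  · rw [hn, revCorner_spiralFrom o hk (by norm_num), revCorner_spiralFrom o hk (by norm_num), hpred]
    by_cases hf : (legState k).IsFirst
    · refine Or.inl ⟨by simp [LegState.inner_eq_pred_iff.2 hf], ?_⟩
      rw [hu]
      exact (LegState.mem_segment_of_isFirst hs hf h).imp (by simp +contextual)
        add_mem_gridSegment
    · refine Or.inr ⟨?_, ?_⟩
      · refine Finset.card_pair fun he => hf ?_
        exact LegState.inner_eq_pred_iff.1 (add_left_cancel he)
      · rw [hu]
        exact (LegState.mem_segment_of_not_isFirst hs hf h).imp (by simp +contextual)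
          add_mem_gridSegment

theorem natAbs_sub_le_height {T : List Node} {u v : Node} (hu : u ∈ T) (hv : v ∈ T) :
    (u.2 - v.2).natAbs ≤ height T :=
  (Finset.le_sup (f := fun v : Node => (u.2 - v.2).natAbs) (List.mem_toFinset.2 hv)).trans
    (Finset.le_sup (f := fun u : Node => T.toFinset.sup fun v => (u.2 - v.2).natAbs)
      (List.mem_toFinset.2 hu))

theorem height_le {T : List Node} {n : ℕ} (h : ∀ u ∈ T, ∀ v ∈ T, (u.2 - v.2).natAbs ≤ n) :
    height T ≤ n :=
  Finset.sup_le fun u hu => Finset.sup_le fun v hv =>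
    h u (List.mem_toFinset.1 hu) v (List.mem_toFinset.1 hv)

theorem width_le {T : List Node} {n : ℕ} (h : ∀ u ∈ T, ∀ v ∈ T, (u.1 - v.1).natAbs ≤ n) :
    width T ≤ n :=
  Finset.sup_le fun u hu => Finset.sup_le fun v hv =>
    h u (List.mem_toFinset.1 hu) v (List.mem_toFinset.1 hv)

theorem height_spiralFrom (o : Node) {k : ℕ} (hk : 0 < k) :
    (height (spiralFrom o k) : ℤ) = (legState k).vertical := by
  have hs := started_legState hk
  have hu : ∀ u ∈ spiralFrom o k, ∀ v ∈ spiralFrom o k,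
      (u.2 - v.2).natAbs ≤ (legState k).vertical.toNat := by
    intro u hu v hv
    rw [mem_spiralFrom] at hu hv
    generalize legState k = s at *
    obtain ⟨_ | _ | _ | _, p, q⟩ := s <;>
      simp only [LegState.Started, LegState.Region, LegState.vertical] at * <;> omega
  have hl : ∃ u ∈ spiralFrom o k, ∃ v ∈ spiralFrom o k,
      (u.2 - v.2).natAbs = (legState k).vertical.toNat := by
    simp only [mem_spiralFrom]
    generalize legState k = s at *
    obtain ⟨_ | _ | _ | _, p, q⟩ := s <;>
      simp only [LegState.Started, LegState.Region, LegState.vertical] at *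
    · refine ⟨o + (-p, p), ?_, o + (-p, -p), ?_⟩ <;> simp <;> omega
    · refine ⟨o + (q, p + 1), ?_, o + (q, -p - 1), ?_⟩ <;> simp <;> omega
    · refine ⟨o + (p, p + 1), ?_, o + (p, -p), ?_⟩ <;> simp <;> omega
    · refine ⟨o + (q, p + 1), ?_, o + (q, -p), ?_⟩ <;> simp <;> omega
  have h1 := height_le hu
  obtain ⟨u, hu, v, hv, h2⟩ := hl
  have h3 := natAbs_sub_le_height hu hv
  have h4 : 0 ≤ (legState k).vertical := by
    generalize legState k = s at *
    obtain ⟨_ | _ | _ | _, p, q⟩ := s <;>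
      simp only [LegState.Started, LegState.vertical] at * <;> omega
  omega

theorem probeWait_spiralFrom_le (o : Node) {D k : ℕ} (hk : k ≤ 4 * D ^ 2 + 3 * D) :
    probeWait (spiralFrom o k) ≤ 2 * D := by
  have h : ∀ u ∈ spiralFrom o k, (u.1 - o.1).natAbs ≤ D ∧ (u.2 - o.2).natAbs ≤ D := by
    intro u hu
    obtain ⟨i, hi, rfl⟩ := mem_spiralFrom_iff_exists.1 hu
    simpa using natAbs_spiralNode_le (hi.trans hk)
  unfold probeWait
  split_ifs
  · refine height_le fun u hu v hv => ?_
    have := h u hu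
    have := h v hv
    omega
  · refine width_le fun u hu v hv => ?_
    have := h u hu
    have := h v hv
    omega

theorem probeWait_spiralFrom (o : Node) {k : ℕ} (hk : 0 < k) :
    probeWait (spiralFrom o k) = probeWait (spiralPath k) := by
  have h0 : spiralFrom 0 k = spiralPath k := by simp [spiralFrom]
  have hT : (spiralFrom o k).toFinset = (spiralPath k).toFinset.image (o + ·) := by
    ext v
    simp only [List.mem_toFinset, Finset.mem_image, spiralFrom, List.mem_map]
  have hw : width (spiralFrom o k) = width (spiralPath k) := by
    simp only [width, hT, Finset.sup_image, Function.comp_def, Prod.fst_add,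
      add_sub_add_left_eq_sub]
  have hh : height (spiralFrom o k) = height (spiralPath k) := by
    simp only [height, hT, Finset.sup_image, Function.comp_def, Prod.snd_add,
      add_sub_add_left_eq_sub]
  rw [probeWait, probeWait, hw, hh, ← h0]
  simp [predNode_spiralFrom _ hk, lastNode_spiralFrom]

/-! ### Moves after the first hit -/

theorem Dir.vec_opp (d : Dir) : d.opp.vec = -d.vec := by
  cases d <;> simp [Dir.opp, Dir.vec]

theorem moveBy_add (o u : Node) (m : Option Dir) : moveBy (o + u) m = o + moveBy u m := by
  cases m <;> simp [moveBy, add_assoc]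

/-- The `j`-th move after a first hit that occurred after `k` moves. -/
def moveAfter (k j : ℕ) : Option Dir :=
  if j < (probeMoves k).length then (probeMoves k).getD j none
  else thirdPartMove k (j - (probeMoves k).length)

/-- The position `j` rounds after a first hit that occurred after `k` moves, in the coordinates
whose origin is the base. -/
def afterHit (k : ℕ) : ℕ → Node
  | 0 => spiralNode k
  | j + 1 => moveBy (afterHit k j) (moveAfter k j)

/-- The position `n` rounds after the beginning of Action I. -/
def swingNode (k n : ℕ) : Node :=
  spiralNode (if n % (2 * k) ≤ k then k - n % (2 * k) else n % (2 * k) - k)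

theorem length_probeMoves (k : ℕ) : (probeMoves k).length = probeWait (spiralPath k) + 2 := by
  simp [probeMoves]

theorem afterHit_of_le {k j : ℕ} (hj : j ≤ probeWait (spiralPath k)) :
    afterHit k j = spiralNode k := by
  induction j with
  | zero => rfl
  | succ j ih =>
    have : moveAfter k j = none := by
      rw [moveAfter, length_probeMoves, if_pos (by omega), probeMoves,
        List.getD_append _ _ _ _ (by simpa using hj)]
      simp
    rw [afterHit, ih (by omega), this, moveBy]

theorem afterHit_wait_add_one {k : ℕ} (hk : 0 < k) :
    afterHit k (probeWait (spiralPath k) + 1) = spiralNode (k - 1) := by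
  obtain ⟨k, rfl⟩ : ∃ k', k = k' + 1 := ⟨k - 1, by omega⟩
  have : moveAfter (k + 1) (probeWait (spiralPath (k + 1))) = some (squareSpiral k).opp := by
    rw [moveAfter, length_probeMoves, if_pos (by omega), probeMoves,
      List.getD_append_right _ _ _ _ (by simp)]
    simp
  rw [afterHit, afterHit_of_le le_rfl, this, moveBy, Dir.vec_opp, spiralNode]
  simp

theorem afterHit_wait_add_two {k : ℕ} (hk : 0 < k) :
    afterHit k (probeWait (spiralPath k) + 2) = spiralNode k := by
  have : moveAfter k (probeWait (spiralPath k) + 1) = some (squareSpiral (k - 1)) := by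
    rw [moveAfter, length_probeMoves, if_pos (by omega), probeMoves,
      List.getD_append_right _ _ _ _ (by simp)]
    simp
  rw [afterHit, afterHit_wait_add_one hk, this, moveBy]
  obtain ⟨k, rfl⟩ : ∃ k', k = k' + 1 := ⟨k - 1, by omega⟩
  rfl

theorem moveAfter_third (k n : ℕ) :
    moveAfter k (probeWait (spiralPath k) + 2 + n) = thirdPartMove k n := by
  rw [moveAfter, length_probeMoves, if_neg (by omega), Nat.add_sub_cancel_left]

theorem chosenAction_spiralPath {k : ℕ} (hk : 0 < k) :
    (chosenAction (spiralPath k) = some .II ∧ (legState k).Upper) ∨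
      (chosenAction (spiralPath k) = some .I ∧ ¬ (legState k).Upper) := by
  have := chosenAction_spiralFrom 0 hk
  simpa [spiralFrom] using this

theorem afterHit_third_of_upper {k : ℕ} (hk : 0 < k) (hu : (legState k).Upper) (n : ℕ) :
    afterHit k (probeWait (spiralPath k) + 2 + n) = spiralNode k := by
  induction n with
  | zero => exact afterHit_wait_add_two hk
  | succ n ih =>
    have h : chosenAction (spiralPath k) = some .II := by
      have := chosenAction_spiralPath hk
      tauto
    rw [← add_assoc, afterHit, ih, moveAfter_third, thirdPartMove, h]
    rfl

theorem length_swingMoves (k : ℕ) : (swingMoves k).length = 2 * k := by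
  simp [swingMoves, two_mul]

theorem moveBy_swingMoves {k r : ℕ} (hr : r < 2 * k) :
    moveBy (spiralNode (if r ≤ k then k - r else r - k)) ((swingMoves k).getD r none) =
      spiralNode (if r + 1 ≤ k then k - (r + 1) else r + 1 - k) := by
  by_cases h : r + 1 ≤ k
  · have h1 : (swingMoves k).getD r none = some (squareSpiral (k - 1 - r)).opp := by
      rw [swingMoves, List.getD_append _ _ _ _ (by simpa using h),
        List.getD_eq_getElem _ _ (by simpa using h)]
      simp
    rw [if_pos h, if_pos (by omega), h1, moveBy, Dir.vec_opp,
      show k - r = k - 1 - r + 1 by omega, spiralNode, show k - (r + 1) = k - 1 - r by omega]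
    simp
  · have h1 : (swingMoves k).getD r none = some (squareSpiral (r - k)) := by
      rw [swingMoves, List.getD_append_right _ _ _ _ (by simp; omega),
        List.getD_eq_getElem _ _ (by simp; omega)]
      simp
    have h2 : (if r ≤ k then k - r else r - k) = r - k := by split_ifs <;> omega
    rw [if_neg h, h1, moveBy, h2, show r + 1 - k = r - k + 1 by omega, spiralNode]

theorem afterHit_third_of_not_upper {k : ℕ} (hk : 0 < k) (hu : ¬ (legState k).Upper) (n : ℕ) :
    afterHit k (probeWait (spiralPath k) + 2 + n) = swingNode k n := by
  induction n with
  | zero => simpa [swingNode] using afterHit_wait_add_two hk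
  | succ n ih =>
    have h : chosenAction (spiralPath k) = some .I := by
      have := chosenAction_spiralPath hk
      tauto
    have hr : n % (2 * k) < 2 * k := Nat.mod_lt _ (by omega)
    rw [← add_assoc, afterHit, ih, moveAfter_third, thirdPartMove, h, swingNode, swingNode]
    dsimp only
    rw [length_swingMoves, moveBy_swingMoves hr]
    congr 1
    rw [Nat.add_mod n 1, Nat.mod_eq_of_lt (show 1 < 2 * k by omega)]
    rcases Nat.lt_or_ge (n % (2 * k) + 1) (2 * k) with h1 | h1
    · rw [Nat.mod_eq_of_lt h1]
    · rw [show n % (2 * k) + 1 = 2 * k by omega, Nat.mod_self]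
      split_ifs <;> omega

theorem exists_afterHit_eq {k : ℕ} (hk : 0 < k) (j : ℕ) :
    ∃ i ≤ k, afterHit k j = spiralNode i := by
  rcases Nat.lt_or_ge j (probeWait (spiralPath k) + 2) with hj | hj
  · rcases Nat.lt_or_ge (probeWait (spiralPath k)) j with hj' | hj'
    · rw [show j = probeWait (spiralPath k) + 1 by omega]
      exact ⟨_, by omega, afterHit_wait_add_one hk⟩
    · exact ⟨k, le_rfl, afterHit_of_le hj'⟩
  · obtain ⟨n, rfl⟩ := Nat.exists_eq_add_of_le hj
    by_cases hu : (legState k).Upper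
    · exact ⟨k, le_rfl, afterHit_third_of_upper hk hu n⟩
    · refine ⟨_, ?_, afterHit_third_of_not_upper hk hu n⟩
      have hr : n % (2 * k) < 2 * k := Nat.mod_lt _ (by omega)
      split_ifs <;> omega

/-! ### Executions of the algorithm -/

section Execution

variable (base : Agent → Node) (wake : Agent → ℕ)

/-- The position of agent `X` at time `t`. -/
def position (X : Agent) (t : ℕ) : Node := (run hardestScenario base wake t).pos X

/-- The observation of agent `X` made `i` rounds after its wakeup. -/
def seen (X : Agent) : ℕ → Bool
  | 0 => true
  | i + 1 => decide (position base wake X (wake X + (i + 1)) ∈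
      (run hardestScenario base wake (wake X + i)).marked)

/-- The first hit of agent `X` occurs after `k` moves. -/
def HitIndex (X : Agent) (k : ℕ) : Prop :=
  0 < k ∧ seen base wake X k = true ∧ ∀ j, 0 < j → j < k → seen base wake X j = false

variable {base wake}

theorem asleep {X : Agent} {t : ℕ} (ht : t ≤ wake X) :
    position base wake X t = base X ∧ (run hardestScenario base wake t).obs X = [true] := by
  induction t with
  | zero => exact ⟨rfl, rfl⟩
  | succ t ih =>
    have h : ¬ wake X ≤ t := by omega
    obtain ⟨h1, h2⟩ := ih (by omega)
    constructor
    · rw [← h1]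
      simp [position, run, stepConfig, nextPos, h]
    · rw [← h2]
      simp [run, stepConfig, h]

theorem position_succ (X : Agent) (i : ℕ) :
    position base wake X (wake X + (i + 1)) = moveBy (position base wake X (wake X + i))
      (hardestScenario ((run hardestScenario base wake (wake X + i)).obs X)) := by
  simp [position, run, stepConfig, nextPos]

theorem obs_eq (X : Agent) (i : ℕ) : (run hardestScenario base wake (wake X + i)).obs X =
    (List.range (i + 1)).map (seen base wake X) := by
  induction i with
  | zero => simpa [seen] using (asleep (base := base) (X := X) le_rfl).2
  | succ i ih =>
    rw [List.range_succ, List.map_append, ← ih]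
    simp [seen, position, run, stepConfig]

theorem mem_marked {t : ℕ} {v : Node} : v ∈ (run hardestScenario base wake t).marked ↔
    ∃ X, ∃ r ≤ t, position base wake X r = v := by
  have key : ∀ (f : Agent → Node), v ∈ ({f .B, f .R} : Finset Node) ↔ ∃ X, f X = v := by
    intro f
    rw [Finset.mem_insert, Finset.mem_singleton]
    constructor
    · rintro (h | h)
      · exact ⟨_, h.symm⟩
      · exact ⟨_, h.symm⟩
    · rintro ⟨_ | _, h⟩
      · exact Or.inl h.symm
      · exact Or.inr h.symm
  induction t with
  | zero =>
    simp only [Nat.le_zero, exists_eq_left]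
    exact key _
  | succ t ih =>
    refine Finset.mem_union.trans ((or_congr ih (key _)).trans ?_)
    constructor
    · rintro (⟨X, r, hr, h⟩ | ⟨X, h⟩)
      · exact ⟨X, r, by omega, h⟩
      · exact ⟨X, t + 1, le_rfl, h⟩
    · rintro ⟨X, r, hr, h⟩
      rcases Nat.lt_or_ge t r with h1 | h1
      · obtain rfl : r = t + 1 := by omega
        exact Or.inr ⟨X, h⟩
      · exact Or.inl ⟨X, r, h1, h⟩

theorem seen_eq_true {X : Agent} {k : ℕ} (hk : 0 < k) : seen base wake X k = true ↔
    ∃ Y, ∃ r < wake X + k, position base wake Y r = position base wake X (wake X + k) := by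
  obtain ⟨k, rfl⟩ : ∃ k', k = k' + 1 := ⟨k - 1, by omega⟩
  simp only [seen, decide_eq_true_eq, mem_marked, ← add_assoc, Nat.lt_succ_iff]

theorem firstHit_pred (b : ℕ → Bool) (n k : ℕ) (hk : k < n) :
    (decide (0 < k) && ((List.range n).map b).getD k false &&
      decide (spiralNode k ∉ (List.range k).map spiralNode)) = (decide (0 < k) && b k) := by
  have h : spiralNode k ∉ (List.range k).map spiralNode := by
    intro h
    obtain ⟨i, hi, h⟩ := List.mem_map.1 h
    rw [spiralNode_injective h] at hi
    simp at hi
  simp [h, hk]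

theorem firstHit_eq_none {b : ℕ → Bool} {n : ℕ} (h : ∀ j, 0 < j → j < n → b j = false) :
    firstHit ((List.range n).map b) = none := by
  rw [firstHit, List.find?_eq_none]
  intro k hk
  simp only [List.length_map, List.length_range, List.mem_range] at hk
  rw [firstHit_pred _ _ _ hk]
  rcases Nat.eq_zero_or_pos k with rfl | h0
  · simp
  · simp [h k h0 hk]

theorem firstHit_eq_some {b : ℕ → Bool} {n k : ℕ} (hk : 0 < k) (hn : k < n) (hb : b k = true)
    (h : ∀ j, 0 < j → j < k → b j = false) :
    firstHit ((List.range n).map b) = some k := by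
  rw [firstHit, List.length_map, List.length_range, List.find?_range_eq_some]
  refine ⟨?_, by simpa using hn, fun j hj => ?_⟩
  · rw [firstHit_pred _ _ _ hn]
    simp [hk, hb]
  · rw [firstHit_pred _ _ _ (by omega)]
    rcases Nat.eq_zero_or_pos j with rfl | h0
    · simp
    · simp [h j h0 hj]

/-- Until its first hit, an agent follows the spiral. -/
theorem position_of_le {X : Agent} {k i : ℕ}
    (h : ∀ j, 0 < j → j < k → seen base wake X j = false) (hi : i ≤ k) :
    position base wake X (wake X + i) = base X + spiralNode i := by
  induction i with
  | zero =>
    rw [add_zero, (asleep le_rfl).1, spiralNode]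
    exact (add_zero _).symm
  | succ i ih =>
    rw [position_succ, ih (by omega), obs_eq, hardestScenario,
      firstHit_eq_none fun j h0 hj => h j h0 (by omega)]
    simp [moveBy, spiralNode, add_assoc]

/-- The positions of an agent after its first hit. -/
theorem position_afterHit {X : Agent} {k : ℕ} (h : HitIndex base wake X k) (j : ℕ) :
    position base wake X (wake X + k + j) = base X + afterHit k j := by
  obtain ⟨h0, h1, h2⟩ := h
  induction j with
  | zero => exact position_of_le h2 le_rfl
  | succ j ih =>
    rw [show wake X + k + (j + 1) = wake X + (k + j + 1) by omega, position_succ, ← add_assoc, ih,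
      add_assoc, obs_eq, hardestScenario, firstHit_eq_some h0 (by omega) h1 h2, moveBy_add, afterHit]
    simp only [List.length_map, List.length_range, show k + j + 1 - 1 - k = j by omega]
    rfl

theorem HitIndex.position_of_le {X : Agent} {k i : ℕ} (h : HitIndex base wake X k) (hi : i ≤ k) :
    position base wake X (wake X + i) = base X + spiralNode i :=
  GridRendezvous.position_of_le h.2.2 hi

/-- All positions of an agent are on its main trajectory. -/
theorem HitIndex.exists_position {X : Agent} {k : ℕ} (h : HitIndex base wake X k) (r : ℕ) :
    ∃ i ≤ k, i ≤ r - wake X ∧ position base wake X r = base X + spiralNode i := by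
  rcases Nat.lt_or_ge r (wake X) with h1 | h1
  · refine ⟨0, by omega, by omega, ?_⟩
    rw [(asleep h1.le).1, spiralNode]
    exact (add_zero _).symm
  · obtain ⟨i, rfl⟩ := Nat.exists_eq_add_of_le h1
    rcases Nat.lt_or_ge i k with h2 | h2
    · exact ⟨i, h2.le, by omega, h.position_of_le h2.le⟩
    · obtain ⟨j, rfl⟩ := Nat.exists_eq_add_of_le h2
      obtain ⟨i, hi, hj⟩ := exists_afterHit_eq h.1 j
      exact ⟨i, hi, by omega, by rw [← add_assoc, position_afterHit h, hj]⟩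

theorem exists_hitIndex_of_seen {X : Agent} {n : ℕ} (hn : 0 < n)
    (h : seen base wake X n = true) : ∃ k ≤ n, HitIndex base wake X k := by
  have hex : ∃ k, 0 < k ∧ seen base wake X k = true := ⟨n, hn, h⟩
  classical
  exact ⟨Nat.find hex, Nat.find_min' hex ⟨hn, h⟩, (Nat.find_spec hex).1, (Nat.find_spec hex).2,
    fun i h0 hi => by simpa [h0] using Nat.find_min hex hi⟩

/-- An agent makes its first hit at the latest at the base of the other agent. -/
theorem exists_hitIndex {X : Agent} {n : ℕ} (hn : 0 < n)
    (h : base X + spiralNode n = base X.other) : ∃ k ≤ n, HitIndex base wake X k := by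
  by_cases hs : ∃ j, 0 < j ∧ j < n ∧ seen base wake X j = true
  · obtain ⟨j, h0, hj, h1⟩ := hs
    obtain ⟨k, hk, h2⟩ := exists_hitIndex_of_seen h0 h1
    exact ⟨k, by omega, h2⟩
  · refine exists_hitIndex_of_seen hn ((seen_eq_true hn).2 ⟨X.other, 0, by omega, ?_⟩)
    rw [GridRendezvous.position_of_le (k := n) (fun j h0 hj => ?_) le_rfl, h]
    · rfl
    · by_contra hne
      exact hs ⟨j, h0, hj, by simpa using hne⟩

theorem HitIndex.makesHit {X : Agent} {k : ℕ} (h : HitIndex base wake X k) :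
    MakesHit hardestScenario base wake X (wake X + k) := by
  obtain ⟨k, rfl⟩ : ∃ k', k = k' + 1 := ⟨k - 1, by have := h.1; omega⟩
  refine ⟨wake X + k, by omega, by omega, ?_, fun r hr he => ?_⟩
  · exact of_decide_eq_true h.2.1
  · have h1 := h.position_of_le le_rfl
    obtain ⟨i, -, hi, h2⟩ := h.exists_position r
    have h3 : position base wake X r = position base wake X (wake X + (k + 1)) := he
    rw [h1, h2] at h3
    have := spiralNode_injective (add_left_cancel h3)
    omega

theorem exists_hitIndex_of_isFirstHit {X : Agent} {t : ℕ}
    (h : IsFirstHit hardestScenario base wake X t) :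
    ∃ k, t = wake X + k ∧ HitIndex base wake X k := by
  obtain ⟨⟨s, rfl, hs, hm, -⟩, hmin⟩ := h
  obtain ⟨j, rfl⟩ := Nat.exists_eq_add_of_le hs
  obtain ⟨k, hk, hX⟩ := exists_hitIndex_of_seen (X := X) (n := j + 1) (by omega) (decide_eq_true hm)
  have h1 := hmin hX.makesHit
  exact ⟨k, by omega, hX⟩

theorem HitIndex.trajectory_eq {X : Agent} {k : ℕ} (h : HitIndex base wake X k) :
    trajectory hardestScenario base wake X (wake X + k) = spiralFrom (base X) k := by
  rw [trajectory, spiralFrom, spiralPath, List.map_map, Nat.add_sub_cancel_left]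
  refine List.map_congr_left fun i hi => ?_
  exact h.position_of_le (by simpa [Nat.lt_succ_iff] using hi)

end Execution

/-! ### Two agents with first hits that do not meet before the later hit -/

section TwoAgents

variable {base : Agent → Node} {wake k : Agent → ℕ}

theorem Agent.other_other (X : Agent) : X.other.other = X := by cases X <;> rfl

theorem Agent.eq_or_eq_other (X Y : Agent) : Y = X ∨ Y = X.other := by
  cases X <;> cases Y <;> simp [Agent.other]

theorem meets_iff (X : Agent) {t : ℕ} : Meets hardestScenario base wake t ↔
    position base wake X t = position base wake X.other t := by
  cases X
  · exact Iff.rfl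
  · exact eq_comm

/-- The agents `B` and `R` make their first hits after `k .B` and `k .R` moves, and they do not
meet before both hits have occurred. -/
structure LateMeeting (base : Agent → Node) (wake k : Agent → ℕ) : Prop where
  hit (X : Agent) : HitIndex base wake X (k X)
  apart (X : Agent) (s : ℕ) (hs : s < wake X + k X) : ¬ Meets hardestScenario base wake s

/-- The node of the first hit was visited by the other agent before. -/
theorem LateMeeting.exists_visit (h : LateMeeting base wake k) (X : Agent) :
    ∃ i ≤ k X.other, base X + spiralNode (k X) = base X.other + spiralNode i ∧
      wake X.other + i < wake X + k X := by
  obtain ⟨Y, r, hr, he⟩ := (seen_eq_true (h.hit X).1).1 (h.hit X).2.1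
  have hX := (h.hit X).position_of_le le_rfl
  obtain ⟨i, hi, hir, hY⟩ := (h.hit Y).exists_position r
  rw [hX, hY] at he
  have h0 := (h.hit X).1
  obtain rfl | rfl := X.eq_or_eq_other Y
  · have := spiralNode_injective (add_left_cancel he)
    omega
  · refine ⟨i, hi, he.symm, ?_⟩
    by_contra hlt
    obtain rfl : i = 0 := by omega
    have h1 := (h.hit X.other).1
    refine h.apart X.other (wake X + k X) (by omega) ((meets_iff X).2 ?_)
    rw [hX, ← he, (asleep (by omega)).1, spiralNode]
    exact add_zero _

theorem LateMeeting.not_earlier (h : LateMeeting base wake k) (X : Agent) {i j : ℕ}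
    (hj : j ≤ k X) (hi : i < k X.other)
    (he : base X + spiralNode j = base X.other + spiralNode i) :
    wake X.other + i ≤ wake X + j := by
  by_contra hlt
  have hX := (h.hit X).position_of_le hj
  have hY := (h.hit X.other).position_of_le hi.le
  rcases Nat.eq_zero_or_pos i with rfl | h0
  · refine h.apart X.other (wake X + j) (by omega) ((meets_iff X).2 ?_)
    rw [hX, he, (asleep (by omega)).1, spiralNode]
    exact add_zero _
  · have h1 := (h.hit X.other).2.2 i h0 hi
    rw [(seen_eq_true h0).2 ⟨X, wake X + j, by omega, by rw [hX, hY, he]⟩] at h1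
    exact absurd h1 (by simp)

theorem LateMeeting.eq_or_eq (h : LateMeeting base wake k) (X : Agent) {i j : ℕ}
    (hj : j ≤ k X) (hi : i ≤ k X.other)
    (he : base X + spiralNode j = base X.other + spiralNode i) : j = k X ∨ i = k X.other := by
  by_contra! hne
  have h1 := h.not_earlier X hj (by omega) he
  have h2 := h.not_earlier X.other (i := j) hi (by rw [X.other_other]; omega)
    (by rw [X.other_other, he])
  rw [X.other_other] at h2
  refine h.apart X (wake X + j) (by omega) ((meets_iff X).2 ?_)
  rw [(h.hit X).position_of_le hj, he, ← (h.hit X.other).position_of_le hi]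
  congr 1
  omega

theorem LateMeeting.hit_ne (h : LateMeeting base wake k) (X : Agent) :
    base X + spiralNode (k X) ≠ base X.other + spiralNode (k X.other) := by
  intro he
  obtain ⟨i, -, h1, h2⟩ := h.exists_visit X
  obtain ⟨j, -, h3, h4⟩ := h.exists_visit X.other
  rw [X.other_other] at h3 h4
  have := spiralNode_injective (add_left_cancel (he.symm.trans h1))
  have := spiralNode_injective (add_left_cancel (he.trans h3))
  omega

theorem LateMeeting.meetAtTips (h : LateMeeting base wake k) (X : Agent) :
    (legState (k X)).MeetAtTips (legState (k X.other))
      ((base X.other).1 - (base X).1) ((base X.other).2 - (base X).2) := by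
  have hmem : ∀ (Y : Agent) (x y : ℤ), (legState (k Y)).Region x y ↔
      ∃ i ≤ k Y, spiralNode i = (x, y) := by
    intro Y x y
    rw [← mem_spiralPath_iff_exists, mem_spiralPath]
  refine ⟨?_, ?_, ?_, ?_⟩
  · obtain ⟨i, hi, h1, -⟩ := h.exists_visit X
    rw [hmem]
    refine ⟨i, hi, ?_⟩
    rw [spiralNode_eq_tip (k X), Prod.ext_iff] at h1
    simp only [Prod.fst_add, Prod.snd_add] at h1
    ext <;> dsimp only <;> omega
  · obtain ⟨i, hi, h1, -⟩ := h.exists_visit X.other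
    rw [X.other_other] at h1 hi
    rw [hmem]
    refine ⟨i, hi, ?_⟩
    rw [spiralNode_eq_tip (k X.other), Prod.ext_iff] at h1
    simp only [Prod.fst_add, Prod.snd_add] at h1
    ext <;> dsimp only <;> omega
  · have h1 := h.hit_ne X
    rw [spiralNode_eq_tip, spiralNode_eq_tip, Ne, Prod.ext_iff] at h1
    simp only [Prod.fst_add, Prod.snd_add] at h1
    omega
  · intro x y hx hy
    rw [hmem] at hx hy
    obtain ⟨j, hj, h1⟩ := hx
    obtain ⟨i, hi, h2⟩ := hy
    have h3 := h.eq_or_eq X hj hi (by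
      rw [h1, h2]
      ext <;> simp <;> ring)
    rcases h3 with rfl | rfl
    · left
      rw [← spiralNode_eq_tip, h1]
      exact ⟨rfl, rfl⟩
    · right
      rw [← spiralNode_eq_tip, h2]
      constructor <;> dsimp only <;> ring

theorem LateMeeting.separated (h : LateMeeting base wake k) (X : Agent) :
    (legState (k X)).Separated (legState (k X.other))
      ((base X.other).1 - (base X).1) ((base X.other).2 - (base X).2) :=
  (h.meetAtTips X).separated (started_legState (h.hit _).1) (started_legState (h.hit _).1)

/-- The main trajectory of an agent. -/
def mainTrajectory (base : Agent → Node) (k : Agent → ℕ) (X : Agent) : List Node :=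
  spiralFrom (base X) (k X)

theorem LateMeeting.hitRegion (h : LateMeeting base wake k) (X : Agent) :
    HitRegion (mainTrajectory base k X) (lastNode (mainTrajectory base k X.other)) := by
  rw [mainTrajectory, mainTrajectory, lastNode_spiralFrom, spiralNode_eq_tip]
  refine hitRegion_spiralFrom (h.hit X).1 ?_
  convert (h.separated X).1.1 using 1 <;> simp <;> ring

/-- The agents run into each other on a horizontal edge, and their trajectories have different
heights. -/
def HeadOn (base : Agent → Node) (k : Agent → ℕ) (X : Agent) : Prop :=
  lastNode (mainTrajectory base k X) = predNode (mainTrajectory base k X.other) ∧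
    lastNode (mainTrajectory base k X.other) = predNode (mainTrajectory base k X) ∧
    probeWait (mainTrajectory base k X) ≠ probeWait (mainTrajectory base k X.other)

theorem differentActions_of_upper (h : LateMeeting base wake k)
    (hu : (legState (k .B)).Upper ↔ ¬ (legState (k .R)).Upper) :
    DifferentActions (mainTrajectory base k .B) (mainTrajectory base k .R) := by
  rcases chosenAction_spiralFrom (base .B) (h.hit .B).1 with ⟨h1, h2⟩ | ⟨h1, h2⟩ <;>
    rcases chosenAction_spiralFrom (base .R) (h.hit .R).1 with ⟨h3, h4⟩ | ⟨h3, h4⟩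
  · tauto
  · exact ⟨_, _, h1, h3, by simp⟩
  · exact ⟨_, _, h1, h3, by simp⟩
  · tauto

theorem LateMeeting.upper_or_headOn (h : LateMeeting base wake k) :
    ((legState (k .B)).Upper ↔ ¬ (legState (k .R)).Upper) ∨ HeadOn base k .B := by
  refine (h.separated .B).2.imp_right ?_
  rintro ⟨h1, h2, h3, h4⟩
  have hB := (h.hit .B).1
  have hR := (h.hit .R).1
  rw [legState_pred hB, ← spiralNode_eq_tip] at h1
  rw [Agent.other, legState_pred hR, ← spiralNode_eq_tip] at h2
  rw [← spiralNode_eq_tip, ← spiralNode_eq_tip] at h3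
  have e1 : lastNode (mainTrajectory base k .B) = predNode (mainTrajectory base k .R) := by
    rw [mainTrajectory, mainTrajectory, lastNode_spiralFrom, predNode_spiralFrom _ hR]
    ext <;> simp only [Prod.fst_add, Prod.snd_add] <;> omega
  have e2 : lastNode (mainTrajectory base k .R) = predNode (mainTrajectory base k .B) := by
    rw [mainTrajectory, mainTrajectory, lastNode_spiralFrom, predNode_spiralFrom _ hB]
    simp only [Agent.other] at h1
    ext <;> simp only [Prod.fst_add, Prod.snd_add] <;> omega
  have e3 : (lastNode (mainTrajectory base k .B)).2 = (lastNode (mainTrajectory base k .R)).2 := by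
    rw [mainTrajectory, mainTrajectory, lastNode_spiralFrom, lastNode_spiralFrom]
    simp only [Agent.other] at h3
    simp only [Prod.snd_add]
    omega
  refine ⟨e1, e2, ?_⟩
  have v1 := height_spiralFrom (base .B) hB
  have v2 := height_spiralFrom (base .R) hR
  rw [Agent.other, probeWait, probeWait, ← e2, ← e1, if_pos e3.symm, if_pos e3, mainTrajectory,
    mainTrajectory]
  rw [Agent.other] at h4
  omega

theorem LateMeeting.meets_of_headOn_of_lt (h : LateMeeting base wake k) (X : Agent)
    (h1 : base X.other + spiralNode (k X.other) = base X + spiralNode (k X - 1))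
    (ht : wake X + k X = wake X.other + k X.other)
    (hw : probeWait (spiralPath (k X)) < probeWait (spiralPath (k X.other))) :
    Meets hardestScenario base wake (wake X + k X + (probeWait (spiralPath (k X)) + 1)) := by
  rw [meets_iff X, position_afterHit (h.hit X), afterHit_wait_add_one (h.hit X).1, ht,
    position_afterHit (h.hit X.other), afterHit_of_le (by omega), h1]

theorem LateMeeting.exists_meets_of_headOn (h : LateMeeting base wake k)
    (hh : HeadOn base k .B) :
    ∃ s < min (thirdPartStart (mainTrajectory base k .B) (wake .B + k .B))
      (thirdPartStart (mainTrajectory base k .R) (wake .R + k .R)),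
      Meets hardestScenario base wake s := by
  obtain ⟨e1, e2, e3⟩ := hh
  have hB := (h.hit .B).1
  have hR := (h.hit .R).1
  simp only [Agent.other, mainTrajectory] at e1 e2 e3
  rw [lastNode_spiralFrom, predNode_spiralFrom _ hR] at e1
  rw [lastNode_spiralFrom, predNode_spiralFrom _ hB] at e2
  rw [probeWait_spiralFrom _ hB, probeWait_spiralFrom _ hR] at e3
  obtain ⟨i, -, h1, h2⟩ := h.exists_visit .B
  obtain ⟨j, -, h3, h4⟩ := h.exists_visit .R
  simp only [Agent.other] at h1 h2 h3 h4
  have hi := spiralNode_injective (add_left_cancel (e1.symm.trans h1))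
  have hj := spiralNode_injective (add_left_cancel (e2.symm.trans h3))
  have ht : wake .B + k .B = wake .R + k .R := by omega
  simp only [thirdPartStart, mainTrajectory, probeWait_spiralFrom _ hB, probeWait_spiralFrom _ hR]
  rcases Nat.lt_or_gt_of_ne e3 with hw | hw
  · exact ⟨_, by omega, h.meets_of_headOn_of_lt .B e2 ht hw⟩
  · exact ⟨_, by omega, h.meets_of_headOn_of_lt .R e1 ht.symm hw⟩

theorem exists_ge_mod_eq (a : ℕ) {c n : ℕ} (hc : c < n) : ∃ m, a ≤ m ∧ m < a + n ∧ m % n = c := by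
  have h1 := Nat.div_add_mod a n
  have h2 := Nat.mod_lt a (show 0 < n by omega)
  rcases Nat.lt_or_ge c (a % n) with h | h
  · refine ⟨n * (a / n + 1) + c, ?_, ?_, ?_⟩
    · rw [mul_add, mul_one]; omega
    · rw [mul_add, mul_one]; omega
    · rw [Nat.mul_add_mod, Nat.mod_eq_of_lt hc]
  · exact ⟨n * (a / n) + c, by omega, by omega, by rw [Nat.mul_add_mod, Nat.mod_eq_of_lt hc]⟩

/-- If agent `X` swings and the other one stays, they meet. -/
theorem LateMeeting.exists_meets_of_swing (h : LateMeeting base wake k) (X : Agent) {M : ℕ}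
    (hX : ¬ (legState (k X)).Upper) (hY : (legState (k X.other)).Upper)
    (h1 : wake X + k X + (probeWait (spiralPath (k X)) + 2) ≤ M)
    (h2 : wake X.other + k X.other + (probeWait (spiralPath (k X.other)) + 2) ≤ M) :
    ∃ s ≤ M + 2 * k X, Meets hardestScenario base wake s := by
  obtain ⟨i, hi, he, -⟩ := h.exists_visit X.other
  rw [X.other_other] at hi he
  have h0 := (h.hit X).1
  obtain ⟨a, ha⟩ := Nat.exists_eq_add_of_le h1
  obtain ⟨n, hn1, hn2, hn3⟩ := exists_ge_mod_eq a (show k X - i < 2 * k X by omega)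
  obtain ⟨m, hm⟩ := Nat.exists_eq_add_of_le (h2.trans (show M ≤ wake X + k X +
    (probeWait (spiralPath (k X)) + 2 + n) by omega))
  refine ⟨wake X + k X + (probeWait (spiralPath (k X)) + 2 + n), by omega, (meets_iff X).2 ?_⟩
  rw [position_afterHit (h.hit X), afterHit_third_of_not_upper h0 hX, hm, add_assoc _ _ m,
    position_afterHit (h.hit X.other), afterHit_third_of_upper (h.hit X.other).1 hY, he, swingNode,
    hn3, if_pos (by omega), show k X - (k X - i) = i by omega]

theorem exists_meets_le {D : ℕ} (hD : gridDist (base .B) (base .R) ≤ D) :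
    ∃ s ≤ max (wake .B) (wake .R) + (12 * D ^ 2 + 14 * D + 2),
      Meets hardestScenario base wake s := by
  by_cases hbase : base .B = base .R
  · exact ⟨0, by omega, hbase⟩
  have hk : ∀ X : Agent, ∃ n ≤ 4 * D ^ 2 + 3 * D, HitIndex base wake X n := by
    intro X
    obtain ⟨n, hn, he⟩ := exists_spiralNode_eq (D := D) (v := base X.other - base X) (by
      cases X <;> simp only [gridDist, Agent.other, Prod.fst_sub, Prod.snd_sub] at * <;> omega)
    have h0 : 0 < n := by
      refine Nat.pos_of_ne_zero ?_
      rintro rfl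
      have : base X.other = base X := sub_eq_zero.1 he.symm
      cases X
      · exact hbase this.symm
      · exact hbase this
    obtain ⟨m, hm, hX⟩ := exists_hitIndex (wake := wake) h0 (show base X + spiralNode n = base X.other
      by rw [he]; abel)
    exact ⟨m, hm.trans hn, hX⟩
  choose k hk hhit using hk
  by_cases hmeet : ∃ X, ∃ s < wake X + k X, Meets hardestScenario base wake s
  · obtain ⟨X, s, hs, hm⟩ := hmeet
    have := hk X
    exact ⟨s, by cases X <;> omega, hm⟩
  have h : LateMeeting base wake k := ⟨hhit, fun X s hs hm => hmeet ⟨X, s, hs, hm⟩⟩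
  have hkB := hk .B
  have hkR := hk .R
  have hwB := probeWait_spiralFrom_le (base .B) hkB
  have hwR := probeWait_spiralFrom_le (base .R) hkR
  rcases h.upper_or_headOn with hu | hh
  · rw [probeWait_spiralFrom _ (hhit .B).1] at hwB
    rw [probeWait_spiralFrom _ (hhit .R).1] at hwR
    set M := max (wake .B) (wake .R) + (4 * D ^ 2 + 3 * D) + (2 * D + 2) with hM
    by_cases hB : (legState (k .B)).Upper
    · obtain ⟨s, hs, hm⟩ := h.exists_meets_of_swing .R (M := M) (hu.1 hB) hB (by omega)
        (by simp only [Agent.other]; omega)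
      exact ⟨s, by omega, hm⟩
    · obtain ⟨s, hs, hm⟩ := h.exists_meets_of_swing .B (M := M) hB (by simp only [Agent.other]; tauto)
        (by omega) (by simp only [Agent.other]; omega)
      exact ⟨s, by omega, hm⟩
  · obtain ⟨s, hs, hm⟩ := h.exists_meets_of_headOn hh
    refine ⟨s, ?_, hm⟩
    simp only [thirdPartStart, mainTrajectory] at hs
    omega

end TwoAgents

theorem isBigO_bound :
    (fun D : ℕ => 12 * (D : ℝ) ^ 2 + 14 * (D : ℝ) + 2) =O[atTop] fun D : ℕ => (D : ℝ) ^ 2 := by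
  refine IsBigO.of_bound 28 ?_
  filter_upwards [eventually_ge_atTop 1] with D hD
  have h : (1 : ℝ) ≤ D := by exact_mod_cast hD
  rw [Real.norm_of_nonneg (by positivity), Real.norm_of_nonneg (by positivity)]
  nlinarith

end GridRendezvous

theorem mainTheorem4 :
    -- rendezvous is guaranteed for arbitrary bases and arbitrary wakeup times
    (∀ (base : Agent → Node) (wake : Agent → ℕ), ∃ t : ℕ, Meets hardestScenario base wake t) ∧
    -- time of rendezvous
    (∀ (D : ℕ) (base : Agent → Node) (wake : Agent → ℕ),
      gridDist (base .B) (base .R) ≤ D →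
        ∃ τ : ℕ, IsRendezvousTime hardestScenario base wake τ ∧
          τ ≤ 12 * D ^ 2 + 14 * D + 2) ∧
    ((fun D : ℕ => 12 * (D : ℝ) ^ 2 + 14 * (D : ℝ) + 2) =O[atTop] fun D : ℕ => (D : ℝ) ^ 2) ∧
    -- both agents make first hits, in rounds `t .B` and `t .R`, and do not meet before
    (∀ (base : Agent → Node) (wake t : Agent → ℕ) (T : Agent → List Node),
      (∀ X, IsFirstHit hardestScenario base wake X (t X)) →
      (∀ s < max (t .B) (t .R), ¬ Meets hardestScenario base wake s) →
      (∀ X, T X = trajectory hardestScenario base wake X (t X)) →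
        (∀ X : Agent, HitRegion (T X) (lastNode (T X.other))) ∧
        ((∃ X : Agent, lastNode (T X) = predNode (T X.other)) →
          (∃ s < min (thirdPartStart (T .B) (t .B)) (thirdPartStart (T .R) (t .R)),
              Meets hardestScenario base wake s) ∨
            DifferentActions (T .B) (T .R)) ∧
        ((∀ X : Agent, lastNode (T X) ≠ predNode (T X.other)) →
          DifferentActions (T .B) (T .R))) := by

  refine ⟨fun base wake => ?_, fun D base wake hD => ?_, isBigO_bound, ?_⟩
  · obtain ⟨s, -, hs⟩ := exists_meets_le (base := base) (wake := wake) le_rfl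
    exact ⟨s, hs⟩
  · obtain ⟨s, hs, hm⟩ := exists_meets_le (wake := wake) hD
    classical
    have hex : ∃ s, Meets hardestScenario base wake s := ⟨s, hm⟩
    refine ⟨_, ⟨Nat.find hex, ⟨Nat.find_spec hex, fun r hr => Nat.find_min' hex hr⟩, rfl⟩, ?_⟩
    have := Nat.find_min' hex hm
    omega
  · intro base wake t T hfirst hapart hT
    choose k htk hhit using fun X => exists_hitIndex_of_isFirstHit (hfirst X)
    have h : LateMeeting base wake k :=
      ⟨hhit, fun X s hs => hapart s (by rw [← htk] at hs; cases X <;> omega)⟩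
    obtain rfl : T = mainTrajectory base k := by
      funext X
      rw [hT, htk, (hhit X).trajectory_eq, mainTrajectory]
    rw [htk .B, htk .R]
    refine ⟨h.hitRegion, fun _ => ?_, fun hne => ?_⟩
    · exact h.upper_or_headOn.symm.imp h.exists_meets_of_headOn (differentActions_of_upper h)
    · exact differentActions_of_upper h (h.upper_or_headOn.resolve_right fun hh => hne .B hh.1)
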